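/- **Setting.** Let $G$ be a planar straight line graph (PSLG): finitely many vertices and nondegenerate segments between them, segments meeting only at common endpoints and containing no other vertices, inside a compact region (the closure of its interior) whose boundary is covered by segments. For a point $y$ on a segment $e$ of $G$, let $\mathrm{LFS}(y)$ (relative to $e$) be the minimum of the distance from $y$ to the farther endpoint of $e$, the distances to the vertices that are not endpoints of $e$, and the distances to the segments sharing no endpoint with $e$. A splitting of all segments into subsegments is *size optimal* with constants $0<A^*\le B^*$ if $A^*\le \mathrm{LFS}(p)/l\le B^*$ whenever $p$ is an endpoint of a subsegment of length $l$ of a segment $e$; put $R=B^*/A^*$. Fix $0<\theta^*<\pi/6$; a triangle is *skinny* if its minimum angle is less than $\theta^*$. *Delaunay refinement* of a split PSLG starts with a truly or constrained Delaunay triangulation of the region with the vertices of the split PSLG, having all subsegments as edges. Repeatedly, among the skinny triangles that are not ignored, one with the shortest shortest edge is chosen, its off-center (the point of the perpendicular bisector of its shortest edge, on the side of its circumcenter, at which this edge subtends the angle $\theta^*$) or its circumcenter, whichever is closer to that edge, is inserted, and the region is retriangulated (truly or constrained Delaunay, with all subsegments as edges). It stops when no such triangle is left. A skinny triangle is *ignored,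 across the angle $\phi$* formed at a common endpoint $x$ by two segments $e,f$ of $G$, if $\phi\le\arccos\frac1{2R}$ and the triangle has a shortest edge $pq$ such that $p\neq x$ is a vertex of the split segment $e$, $q\ne x$ is a vertex of the split segment $f$, and $|pq|<\mathrm{LFS}(p)/B^*$ or $|pq|<\mathrm{LFS}(q)/B^*$. A sequence of splittings, size optimal (for large $n$) with constants $A^*_n,B^*_n$, is *progressively refined* if $A^*_n\to\infty$ and $R_n=B^*_n/A^*_n\to1$. **Theorem.** (1) For each segment $e$ of length $l_e$, let $M_e:[0,T_e]\to[0,l_e]$ be the solution of $M_e'=\mathrm{LFS}(M_e)$, $M_e(0)=0$, $M_e(T_e)=l_e$ (with $e$ parametrized by arc length), and let $T_{\min}=\min_e T_e$. For $n\ge1$, split $e$ at the images under $M_e$ of the points dividing $[0,T_e]$ into $\lfloor nT_e/T_{\min}\rfloor$ equal parts. These splittings are progressively refined, for suitable constants $A_n^*,B_n^*$. (2) Let any progressively refined sequence of splittings of $G$ be given, and let $\phi$ be an angle formed by two adjacent segments of $G$. For all sufficiently large $n$, every ignored triangle across $\phi$, in every mesh that arises during Delaunay refinement of the $n$-th splitting,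 has minimum angle at least $$\arctan\frac{\sin\phi}{(1+R_n)-\cos\phi},$$ and this lower bound tends to $\arctan\frac{\sin\phi}{2-\cos\phi}$ as $n\to\infty$. (3) Let $\phi$ be the minimum angle formed by adjacent segments of $G$. For every progressively refined sequence of splittings and every $\varepsilon>0$, for all sufficiently large $n$, every triangle of every final mesh of the Delaunay refinement of the $n$-th splitting has minimum angle at least $$\min\Big(\theta^*,\ \arctan\frac{\sin\phi}{2-\cos\phi}-\varepsilon\Big).$$ -/

import Mathlib

open Set Filter Topology
open scoped EuclideanGeometry

noncomputable section

/-- The Euclidean plane. -/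
abbrev Plane : Type := EuclideanSpace ℝ (Fin 2)

/-- A straight segment, given by its two endpoints. -/
abbrev Seg : Type := Plane × Plane

namespace Seg

/-- The closed segment as a point set. -/
def carrier (e : Seg) : Set Plane := segment ℝ e.1 e.2

/-- The set of the two endpoints. -/
def ends (e : Seg) : Set Plane := {e.1, e.2}

/-- The length of the segment. -/
def len (e : Seg) : ℝ := dist e.1 e.2

/-- The point of the segment at distance `x` from its first endpoint. -/
def pt (e : Seg) (x : ℝ) : Plane := AffineMap.lineMap e.1 e.2 (x / e.len)

end Seg

/-- A planar straight line graph (the input of the mesh generator): finitely many vertices and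
finitely many nondegenerate segments between vertices, which meet only at common endpoints and
contain no vertex apart from their endpoints, together with the compact region to be meshed, which
contains them and is bounded by segments (other segments are internal boundaries). -/
structure PSLG where
  verts : Finset Plane
  segs : Finset Seg
  domain : Set Plane
  ends_mem : ∀ e ∈ segs, e.1 ∈ verts ∧ e.2 ∈ verts
  nondeg : ∀ e ∈ segs, e.1 ≠ e.2
  inter_subset : ∀ e ∈ segs, ∀ f ∈ segs, e ≠ f → e.carrier ∩ f.carrier ⊆ e.ends ∩ f.ends
  vert_on_seg : ∀ e ∈ segs, ∀ v ∈ verts, v ∈ e.carrier → v ∈ e.ends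
  domain_compact : IsCompact domain
  domain_regular : closure (interior domain) = domain
  verts_subset : ∀ v ∈ verts, v ∈ domain
  segs_subset : ∀ e ∈ segs, e.carrier ⊆ domain
  frontier_subset : frontier domain ⊆ ⋃ e ∈ segs, e.carrier

namespace PSLG

/-- The local feature size at a point `x` of the segment `e`: the smallest among the distance to
the farther endpoint of `e` and the distances to the features not adjacent to `e`, that is, to
the vertices that are not endpoints of `e` and to the segments that share no endpoint with `e`. -/
def lfs (G : PSLG) (e : Seg) (x : Plane) : ℝ :=
  sInf ({max (dist x e.1) (dist x e.2)}
    ∪ {d | ∃ v ∈ G.verts, v ∉ e.ends ∧ d = dist x v}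
    ∪ {d | ∃ f ∈ G.segs, Disjoint e.ends f.ends ∧ d = Metric.infDist x f.carrier})

/-- `e` and `f` are two different segments of `G` with the common endpoint `x`; the other
endpoints are `u` and `v`. The two segments form the angle `∠ u x v`. -/
def Corner (G : PSLG) (e f : Seg) (u x v : Plane) : Prop :=
  e ∈ G.segs ∧ f ∈ G.segs ∧ e ≠ f ∧ (e = (x, u) ∨ e = (u, x)) ∧ (f = (x, v) ∨ f = (v, x))

/-- The angles formed by adjacent segments of `G`. -/
def angles (G : PSLG) : Set ℝ :=
  {φ | ∃ e f u x v, G.Corner e f u x v ∧ φ = ∠ u x v}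

/-- A splitting of all segments of `G` into subsegments: the segment `e` is cut into `num e`
subsegments at the points at distance `pos e 0 < pos e 1 < ⋯ < pos e (num e)` from `e.1`. -/
structure Splitting (G : PSLG) where
  num : Seg → ℕ
  pos : Seg → ℕ → ℝ
  num_pos : ∀ e ∈ G.segs, 0 < num e
  pos_zero : ∀ e ∈ G.segs, pos e 0 = 0
  pos_num : ∀ e ∈ G.segs, pos e (num e) = e.len
  pos_lt : ∀ e ∈ G.segs, ∀ k < num e, pos e k < pos e (k + 1)

namespace Splitting

variable {G : PSLG}

/-- The `k`-th vertex of the split segment `e`. -/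
def vertex (S : Splitting G) (e : Seg) (k : ℕ) : Plane := e.pt (S.pos e k)

/-- The vertices into which the segment `e` is split (endpoints included). -/
def verticesOn (S : Splitting G) (e : Seg) : Set Plane := {p | ∃ k ≤ S.num e, p = S.vertex e k}

/-- The length of the `k`-th subsegment of `e`. -/
def subLen (S : Splitting G) (e : Seg) (k : ℕ) : ℝ := S.pos e (k + 1) - S.pos e k

/-- Size optimality with constants `A`, `B`: `A ≤ LFS(p) / l ≤ B` whenever `p` is an endpoint of
a subsegment of length `l`. -/
def SizeOptimal (S : Splitting G) (A B : ℝ) : Prop :=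
  0 < A ∧ ∀ e ∈ G.segs, ∀ k < S.num e, ∀ p ∈ ({S.vertex e k, S.vertex e (k + 1)} : Set Plane),
    A ≤ G.lfs e p / S.subLen e k ∧ G.lfs e p / S.subLen e k ≤ B

end Splitting

/-- `M` is the mapping function of the segment `e`, from its reference segment `[0, T]`: the
solution of `M' = LFS(M)` with `M 0 = 0` and `M T` the length of `e`. -/
def IsMappingFunction (G : PSLG) (e : Seg) (M : ℝ → ℝ) (T : ℝ) : Prop :=
  0 < T ∧ M 0 = 0 ∧ M T = e.len ∧
    ∀ t ∈ Icc 0 T, HasDerivWithinAt M (G.lfs e (e.pt (M t))) (Icc 0 T) t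

/-- `S` is the splitting produced by the mapping functions `M e` on the reference segments
`[0, T e]` when the shortest reference segment is split into `n` equal parts: the reference segment
of `e` is split into `⌊n * T e / T_min⌋` equal parts, and the division points are mapped to `e`. -/
def IsODESplitting (G : PSLG) (M : Seg → ℝ → ℝ) (T : Seg → ℝ) (n : ℕ) (S : Splitting G) : Prop :=
  ∀ e ∈ G.segs, S.num e = ⌊(n : ℝ) * (T e / sInf (T '' (G.segs : Set Seg)))⌋₊ ∧
    ∀ k ≤ S.num e, S.pos e k = M e ((k : ℝ) * (T e / (S.num e : ℝ)))

/-- The splittings `S n` are size optimal with constants `A n`, `B n` (for large `n`), and are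
progressively refined: `A n → ∞` and `R n = B n / A n → 1`. -/
def ProgressivelyRefined (G : PSLG) (S : ℕ → Splitting G) (A B : ℕ → ℝ) : Prop :=
  (∀ᶠ n in atTop, (S n).SizeOptimal (A n) (B n)) ∧
    Tendsto A atTop atTop ∧ Tendsto (fun n => B n / A n) atTop (𝓝 1)

end PSLG

/-! ### Triangles -/

/-- The smallest angle of a triangle, given by the set of its three vertices. -/
def minAngle (t : Finset Plane) : ℝ :=
  sInf {α | ∃ a ∈ t, ∃ b ∈ t, ∃ c ∈ t, a ≠ b ∧ b ≠ c ∧ c ≠ a ∧ α = ∠ a b c}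

/-- `pq` is a shortest edge of the triangle `t`. -/
def IsShortestEdge (t : Finset Plane) (p q : Plane) : Prop :=
  p ∈ t ∧ q ∈ t ∧ p ≠ q ∧ ∀ a ∈ t, ∀ b ∈ t, a ≠ b → dist p q ≤ dist a b

/-- The circle with center `o` and radius `r` passes through the vertices of `t`. -/
def IsCircumcircle (t : Finset Plane) (o : Plane) (r : ℝ) : Prop := ∀ v ∈ t, dist v o = r

/-! ### Meshes -/

/-- A finite set of vertices and a finite set of triangles (each given by its vertices). -/
structure Mesh where
  verts : Finset Plane
  tris : Finset (Finset Plane)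

/-- The two kinds of Delaunay meshes. -/
inductive MeshKind where
  | truly
  | constrained

namespace PSLG

variable (G : PSLG)

/-- The point `w` is visible from `b`: no segment of `G` cuts the line of sight. -/
def Visible (b w : Plane) : Prop := ∀ e ∈ G.segs, Disjoint (openSegment ℝ b w) e.carrier

/-- `m` is a triangulation of the domain of `G` in which all subsegments of the splitting `S` are
edges. -/
structure IsConforming (S : Splitting G) (m : Mesh) : Prop where
  card_eq : ∀ t ∈ m.tris, t.card = 3
  nondeg : ∀ t ∈ m.tris, AffineIndependent ℝ (fun v : t => (v : Plane))
  verts_eq : ∀ v, v ∈ m.verts ↔ ∃ t ∈ m.tris, v ∈ t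
  face_to_face : ∀ t ∈ m.tris, ∀ t' ∈ m.tris,
    convexHull ℝ (t : Set Plane) ∩ convexHull ℝ (t' : Set Plane) =
      convexHull ℝ ((t : Set Plane) ∩ (t' : Set Plane))
  cover : (⋃ t ∈ m.tris, convexHull ℝ (t : Set Plane)) = G.domain
  subsegment_edge : ∀ e ∈ G.segs, ∀ k < S.num e,
    ∃ t ∈ m.tris, S.vertex e k ∈ t ∧ S.vertex e (k + 1) ∈ t

/-- The Delaunay property. Truly Delaunay: no mesh vertex lies inside the circumcircle of a
triangle. Constrained Delaunay: a mesh vertex inside the circumcircle of a triangle is not visible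
from any point of the interior of that triangle. -/
def IsDelaunay : MeshKind → Mesh → Prop
  | .truly, m => ∀ t ∈ m.tris, ∀ o r, IsCircumcircle t o r → ∀ w ∈ m.verts, ¬ dist w o < r
  | .constrained, m => ∀ t ∈ m.tris, ∀ o r, IsCircumcircle t o r → ∀ w ∈ m.verts, dist w o < r →
      ∀ b ∈ interior (convexHull ℝ (t : Set Plane)), ¬ G.Visible b w

variable {G}

/-- The triangle `t` is across the angle formed at `x` by the segments `e` and `f`, with a short
edge: it has a shortest edge `pq`, where `p ≠ x` is a vertex of the split segment `e` and `q ≠ x`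
one of the split segment `f`, and `|pq| < LFS(p) / B` or `|pq| < LFS(q) / B`. -/
def Across (S : Splitting G) (B : ℝ) (e f : Seg) (x : Plane) (t : Finset Plane) : Prop :=
  ∃ p ∈ S.verticesOn e, ∃ q ∈ S.verticesOn f, p ≠ x ∧ q ≠ x ∧ IsShortestEdge t p q ∧
    (dist p q < G.lfs e p / B ∨ dist p q < G.lfs f q / B)

/-- The triangle `t` is skinny (its minimum angle is less than `θ`) and is ignored by the
refinement, as it is across the angle `∠ u x v` of `G`, formed by the segments `e` and `f`, and
this angle is small, that is, at most `arccos (1 / (2 R))` with `R = B / A`. -/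
def IgnoredAt (S : Splitting G) (A B θ : ℝ) (e f : Seg) (u x v : Plane) (t : Finset Plane) : Prop :=
  G.Corner e f u x v ∧ ∠ u x v ≤ Real.arccos (1 / (2 * (B / A))) ∧
    Across S B e f x t ∧ minAngle t < θ

/-- The triangle `t` is to be eliminated: it is skinny and not ignored. -/
def Eliminable (S : Splitting G) (A B θ : ℝ) (t : Finset Plane) : Prop :=
  minAngle t < θ ∧ ¬ ∃ e f u x v, IgnoredAt S A B θ e f u x v t

end PSLG

/-- `c` is the off-center of a triangle with shortest edge `pq` and circumcenter `o`: the point of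
the perpendicular bisector of `pq`, on the same side of `pq` as `o`, at which `pq` subtends the
angle `θ`. -/
def IsOffCenter (θ : ℝ) (p q o c : Plane) : Prop :=
  dist c p = dist c q ∧ ∠ p c q = θ ∧
    ∃ s : ℝ, 0 < s ∧ c - midpoint ℝ p q = s • (o - midpoint ℝ p q)

/-- `c` is the point inserted to eliminate a triangle with shortest edge `pq` and circumcenter `o`:
the off-center or the circumcenter, whichever is closer to the edge (both lie on the perpendicular
bisector of `pq`). -/
def IsInsertionPoint (θ : ℝ) (p q o c : Plane) : Prop :=
  ∃ c', IsOffCenter θ p q o c' ∧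
    ((dist c' (midpoint ℝ p q) ≤ dist o (midpoint ℝ p q) ∧ c = c') ∨
      (dist o (midpoint ℝ p q) < dist c' (midpoint ℝ p q) ∧ c = o))

namespace PSLG

variable {G : PSLG}

/-- The meshes that arise during the Delaunay refinement of the split PSLG. One starts with a
(truly or constrained) Delaunay mesh whose vertices are those of the split PSLG. In each step, one
takes, among the skinny triangles that are not ignored, one with the shortest shortest edge, inserts
its off-center or its circumcenter, and retriangulates. -/
inductive Refinement (S : Splitting G) (A B θ : ℝ) (κ : MeshKind) : Mesh → Prop
  | init (m : Mesh) (hm : G.IsConforming S m) (hD : G.IsDelaunay κ m)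
      (hv : (m.verts : Set Plane) = (G.verts : Set Plane) ∪ ⋃ e ∈ G.segs, S.verticesOn e) :
      Refinement S A B θ κ m
  | step (m m' : Mesh) (h : Refinement S A B θ κ m) (t : Finset Plane) (p q o c : Plane) (r : ℝ)
      (ht : t ∈ m.tris) (hskinny : Eliminable S A B θ t) (hpq : IsShortestEdge t p q)
      (hmin : ∀ t' ∈ m.tris, Eliminable S A B θ t' →
        ∀ p' q', IsShortestEdge t' p' q' → dist p q ≤ dist p' q')
      (ho : IsCircumcircle t o r) (hc : IsInsertionPoint θ p q o c)
      (hv : (m'.verts : Set Plane) = insert c (m.verts : Set Plane))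
      (hm : G.IsConforming S m') (hD : G.IsDelaunay κ m') :
      Refinement S A B θ κ m'

/-- `m` is a mesh with which the Delaunay refinement stops: no triangle is left to eliminate. -/
def IsRefinedMesh (S : Splitting G) (A B θ : ℝ) (κ : MeshKind) (m : Mesh) : Prop :=
  Refinement S A B θ κ m ∧ ∀ t ∈ m.tris, ¬ Eliminable S A B θ t

end PSLG

end

/-! Part (1): by the mean value theorem, an interval of length h of the reference segment is mapped
to a subsegment of length l = h · LFS(c), with c inside this subsegment. LFS is 1-Lipschitz, so LFS
/ l at either endpoint differs from 1 / h by at most 1 (`lfs_div_bounds`). Here 1 / h = N_e / T_e,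
and the floor in N_e keeps it between (n - 1) / T_min and n / T_min.

Part (2): let p and q lie at distances a and b from the corner x. Since |pq| is at most a constant
over B_n, for large n the edge and the next vertices p', q' beyond it lie near x. Only segments
ending at x come near x, and one that blocked the view within the sector would cross the edge pq; so
x, p', q' are visible from the triangle (`exists_visible`) and not inside its circumcircle. Size
optimality puts p' and q' within (1 + R) a and (1 + R) b of x, so the power P of x satisfies 0 ≤ P ≤
(1 + R) min(a, b)² ≤ (1 + R) a b. The cotangent of the angle opposite to pq is ±(P / (a b) - cos φ)
/ sin φ, with the sign given by the side of pq on which the third vertex lies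
(`inner_sub_of_mem_circle`); both values are at most ((1 + R) - cos φ) / sin φ
(`arctan_le_angle_of_le_dist`). This angle is the minimum angle, as pq is a shortest edge.

Part (3): a skinny triangle of a final mesh is ignored across one of finitely many angles ψ ≥ φ. The
limit bound increases in ψ up to π / 3, and larger angles are eventually ineligible because arccos(1
/ (2 R_n)) → π / 3. -/

namespace Seg

/-! ### Segments and their arc length parametrization -/

lemma len_pos {e : Seg} (h : e.1 ≠ e.2) : 0 < e.len := dist_pos.2 h

lemma pt_zero (e : Seg) : e.pt 0 = e.1 := by simp [pt]

lemma pt_len {e : Seg} (h : e.1 ≠ e.2) : e.pt e.len = e.2 := by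
  simp [pt, (len_pos h).ne']

lemma dist_pt {e : Seg} (h : e.1 ≠ e.2) (s t : ℝ) : dist (e.pt s) (e.pt t) = |s - t| := by
  have h0 := len_pos h
  have h1 : dist e.1 e.2 = e.len := rfl
  rw [pt, pt, dist_lineMap_lineMap, h1, Real.dist_eq, ← sub_div, abs_div, abs_of_pos h0,
    div_mul_cancel₀ _ h0.ne']

lemma pt_mem_carrier {e : Seg} (h : e.1 ≠ e.2) {s : ℝ} (hs : s ∈ Icc 0 e.len) :
    e.pt s ∈ e.carrier := by
  have h0 := len_pos h
  rw [carrier, segment_eq_image_lineMap]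
  exact ⟨s / e.len, ⟨div_nonneg hs.1 h0.le, (div_le_one h0).2 hs.2⟩, rfl⟩

lemma isCompact_carrier (e : Seg) : IsCompact e.carrier := by
  rw [carrier, segment_eq_image_lineMap]
  exact isCompact_Icc.image AffineMap.lineMap_continuous

lemma carrier_nonempty (e : Seg) : e.carrier.Nonempty := ⟨e.1, left_mem_segment ℝ _ _⟩

lemma infDist_carrier_pos {e : Seg} {x : Plane} (hx : x ∉ e.carrier) :
    0 < Metric.infDist x e.carrier :=
  (e.isCompact_carrier.isClosed.notMem_iff_infDist_pos e.carrier_nonempty).1 hx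

end Seg

/-! ### Local feature size -/

namespace PSLG

variable {G : PSLG}

/-- The distances of which the local feature size is the minimum. -/
def lfsSet (G : PSLG) (e : Seg) (x : Plane) : Set ℝ :=
  {max (dist x e.1) (dist x e.2)}
    ∪ {d | ∃ v ∈ G.verts, v ∉ e.ends ∧ d = dist x v}
    ∪ {d | ∃ f ∈ G.segs, Disjoint e.ends f.ends ∧ d = Metric.infDist x f.carrier}

lemma max_mem_lfsSet (e : Seg) (x : Plane) :
    max (dist x e.1) (dist x e.2) ∈ G.lfsSet e x := Or.inl (Or.inl rfl)

lemma lfsSet_nonneg {e : Seg} {x : Plane} {d : ℝ} (hd : d ∈ G.lfsSet e x) : 0 ≤ d := by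
  rcases hd with (rfl | ⟨v, -, -, rfl⟩) | ⟨f, -, -, rfl⟩
  · positivity
  · positivity
  · exact Metric.infDist_nonneg

lemma bddBelow_lfsSet (e : Seg) (x : Plane) : BddBelow (G.lfsSet e x) :=
  ⟨0, fun _ hd => lfsSet_nonneg hd⟩

lemma lfs_nonneg (e : Seg) (x : Plane) : 0 ≤ G.lfs e x :=
  Real.sInf_nonneg fun _ hd => lfsSet_nonneg hd

lemma lfs_le_max (e : Seg) (x : Plane) : G.lfs e x ≤ max (dist x e.1) (dist x e.2) :=
  csInf_le (bddBelow_lfsSet e x) (max_mem_lfsSet e x)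

/-- Each competing distance is 1-Lipschitz in the point, hence so is their infimum. -/
lemma lfs_le_add_dist (e : Seg) (x y : Plane) : G.lfs e x ≤ G.lfs e y + dist x y := by
  rw [← sub_le_iff_le_add]
  refine le_csInf ⟨_, max_mem_lfsSet e y⟩ fun d hd => ?_
  rw [sub_le_iff_le_add]
  rcases hd with (rfl | ⟨v, hv, hve, rfl⟩) | ⟨f, hf, hef, rfl⟩
  · refine (lfs_le_max e x).trans (max_le ?_ ?_)
    · linarith [dist_triangle x y e.1, le_max_left (dist y e.1) (dist y e.2)]
    · linarith [dist_triangle x y e.2, le_max_right (dist y e.1) (dist y e.2)]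
  · refine (csInf_le (bddBelow_lfsSet e x) (Or.inl (Or.inr ⟨v, hv, hve, rfl⟩))).trans ?_
    linarith [dist_triangle x y v]
  · exact (csInf_le (bddBelow_lfsSet e x) (Or.inr ⟨f, hf, hef, rfl⟩)).trans
      Metric.infDist_le_infDist_add_dist

lemma finite_lfsSet (e : Seg) (x : Plane) : (G.lfsSet e x).Finite := by
  refine ((finite_singleton _).union ?_).union ?_
  · refine (G.verts.finite_toSet.image fun v => dist x v).subset ?_
    rintro d ⟨v, hv, -, rfl⟩
    exact ⟨v, hv, rfl⟩
  · refine (G.segs.finite_toSet.image fun f : Seg => Metric.infDist x f.carrier).subset ?_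
    rintro d ⟨f, hf, -, rfl⟩
    exact ⟨f, hf, rfl⟩

/-- The infimum is over finitely many distances, so it is attained, and none of them vanishes by the
incidence axioms of `PSLG`. -/
lemma lfs_pos {e : Seg} (he : e ∈ G.segs) {x : Plane} (hx : x ∈ e.carrier) : 0 < G.lfs e x := by
  have hmem : G.lfs e x ∈ G.lfsSet e x :=
    Set.Nonempty.csInf_mem ⟨_, max_mem_lfsSet e x⟩ (finite_lfsSet e x)
  rcases hmem with (h | ⟨v, hv, hve, h⟩) | ⟨f, hf, hef, h⟩
  · rw [mem_singleton_iff] at h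
    rw [h, lt_max_iff, dist_pos, dist_pos]
    by_contra! hcon
    exact G.nondeg e he (hcon.1.symm.trans hcon.2)
  · rw [h, dist_pos]
    rintro rfl
    exact hve (G.vert_on_seg e he _ hv hx)
  · rw [h]
    refine Seg.infDist_carrier_pos fun hxf => ?_
    have hne : e ≠ f := by
      rintro rfl
      exact disjoint_left.1 hef (Or.inl rfl : e.1 ∈ e.ends) (Or.inl rfl)
    have := G.inter_subset e he f hf hne ⟨hx, hxf⟩
    exact disjoint_left.1 hef this.1 this.2

/-! ### Mapping functions and the splittings they produce -/

namespace IsMappingFunction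

variable {e : Seg} {M : ℝ → ℝ} {T : ℝ}

/-- The mean value theorem; the differential equation enters the argument only through this lemma.
-/
lemma exists_slope (h : G.IsMappingFunction e M T) {s t : ℝ} (hs : 0 ≤ s) (hst : s < t)
    (ht : t ≤ T) : ∃ c ∈ Ioo s t, M t - M s = (t - s) * G.lfs e (e.pt (M c)) := by
  have hsub : Icc s t ⊆ Icc 0 T := Icc_subset_Icc hs ht
  obtain ⟨c, hc, hc'⟩ := exists_hasDerivAt_eq_slope M (fun c => G.lfs e (e.pt (M c))) hst
    (fun c hc => ((h.2.2.2 c (hsub hc)).continuousWithinAt).mono hsub)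
    (fun c hc => (h.2.2.2 c (hsub (Ioo_subset_Icc_self hc))).hasDerivAt
      (Icc_mem_nhds (hs.trans_lt hc.1) (hc.2.trans_le ht)))
  refine ⟨c, hc, ?_⟩
  rw [hc', mul_div_cancel₀]
  linarith

/-- Weak monotonicity comes before `lt`: positivity of LFS is known only on the segment, and that M
stays there is deduced from `mono`. -/
lemma mono (h : G.IsMappingFunction e M T) {s t : ℝ} (hs : 0 ≤ s) (hst : s ≤ t) (ht : t ≤ T) :
    M s ≤ M t := by
  rcases hst.eq_or_lt with rfl | hst
  · rfl
  obtain ⟨c, -, hc⟩ := h.exists_slope hs hst ht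
  have : 0 ≤ (t - s) * G.lfs e (e.pt (M c)) :=
    mul_nonneg (by linarith) (lfs_nonneg e _)
  linarith

lemma mem_Icc (h : G.IsMappingFunction e M T) {t : ℝ} (ht : t ∈ Icc 0 T) :
    M t ∈ Icc 0 e.len := by
  refine ⟨?_, ?_⟩
  · rw [← h.2.1]
    exact h.mono le_rfl ht.1 ht.2
  · rw [← h.2.2.1]
    exact h.mono ht.1 ht.2 le_rfl

lemma lt (h : G.IsMappingFunction e M T) (he : e ∈ G.segs) {s t : ℝ} (hs : 0 ≤ s) (hst : s < t)
    (ht : t ≤ T) : M s < M t := by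
  obtain ⟨c, hc, hc'⟩ := h.exists_slope hs hst ht
  have hcT : c ∈ Icc 0 T := ⟨hs.trans hc.1.le, hc.2.le.trans ht⟩
  have : 0 < (t - s) * G.lfs e (e.pt (M c)) :=
    mul_pos (by linarith)
      (lfs_pos he (Seg.pt_mem_carrier (G.nondeg e he) (h.mem_Icc hcT)))
  linarith

/-- On an interval of length `h` of the reference segment, the local feature size at an endpoint of
the image and the length of the image have a quotient that differs by at most `1` from `1 / h`. -/
lemma lfs_div_bounds (h : G.IsMappingFunction e M T) (he : e ∈ G.segs) {s t r : ℝ} (hs : 0 ≤ s)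
    (hst : s < t) (ht : t ≤ T) (hr : r = s ∨ r = t) :
    1 / (t - s) - 1 ≤ G.lfs e (e.pt (M r)) / (M t - M s) ∧
      G.lfs e (e.pt (M r)) / (M t - M s) ≤ 1 / (t - s) + 1 := by
  obtain ⟨c, hc, hc'⟩ := h.exists_slope hs hst ht
  have hl : 0 < M t - M s := sub_pos.2 (h.lt he hs hst ht)
  have hd : 0 < t - s := sub_pos.2 hst
  have hsc := h.mono hs hc.1.le (hc.2.le.trans ht)
  have hct := h.mono (hs.trans hc.1.le) hc.2.le ht
  have hdist : |M c - M r| ≤ M t - M s := by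
    rw [abs_le]
    rcases hr with rfl | rfl <;> constructor <;> linarith
  have h1 := lfs_le_add_dist (G := G) e (e.pt (M c)) (e.pt (M r))
  have h2 := lfs_le_add_dist (G := G) e (e.pt (M r)) (e.pt (M c))
  rw [dist_comm] at h2
  rw [Seg.dist_pt (G.nondeg e he)] at h1 h2
  -- After multiplication by the image length, both claims say that LFS at c and at r differ by at
  -- most this length.
  have h3 : G.lfs e (e.pt (M c)) = 1 / (t - s) * (M t - M s) := by
    rw [hc']
    field_simp
  rw [le_div_iff₀ hl, div_le_iff₀ hl, sub_mul, add_mul, ← h3]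
  constructor <;> linarith

end IsMappingFunction

/-- The splitting given by the images of equidistant points under the mapping functions. -/
noncomputable def odeSplitting (M : Seg → ℝ → ℝ) (T : Seg → ℝ)
    (h : ∀ e ∈ G.segs, G.IsMappingFunction e (M e) (T e)) (N : Seg → ℕ)
    (hN : ∀ e ∈ G.segs, 0 < N e) : G.Splitting where
  num := N
  pos e k := M e (k * (T e / N e))
  num_pos := hN
  pos_zero e he := by simpa using (h e he).2.1
  pos_num e he := by
    have : (N e : ℝ) ≠ 0 := by exact_mod_cast (hN e he).ne'
    rw [mul_div_cancel₀ _ this]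
    exact (h e he).2.2.1
  pos_lt e he k hk := by
    have hN' : (0 : ℝ) < N e := by exact_mod_cast hN e he
    have hT := (h e he).1
    have hd : 0 < T e / N e := div_pos hT hN'
    refine (h e he).lt he (by positivity) ?_ ?_
    · push_cast
      linarith
    · have : ((k + 1 : ℕ) : ℝ) ≤ N e := by exact_mod_cast hk
      calc ((k + 1 : ℕ) : ℝ) * (T e / N e) ≤ N e * (T e / N e) := by gcongr
        _ = T e := mul_div_cancel₀ _ hN'.ne'

lemma odeSplitting_bounds {M : Seg → ℝ → ℝ} {T : Seg → ℝ}
    (h : ∀ e ∈ G.segs, G.IsMappingFunction e (M e) (T e)) {N : Seg → ℕ}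
    (hN : ∀ e ∈ G.segs, 0 < N e) {A B : ℝ} (hA : 0 < A)
    (hAB : ∀ e ∈ G.segs, A ≤ N e / T e - 1 ∧ N e / T e + 1 ≤ B) :
    (odeSplitting M T h N hN).SizeOptimal A B := by
  refine ⟨hA, fun e he k hk p hp => ?_⟩
  change k < N e at hk
  have hN' : (0 : ℝ) < N e := by exact_mod_cast hN e he
  have hT := (h e he).1
  have hd : 0 < T e / N e := div_pos hT hN'
  have hk1 : ((k + 1 : ℕ) : ℝ) * (T e / N e) ≤ T e := by
    have : ((k + 1 : ℕ) : ℝ) ≤ N e := by exact_mod_cast hk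
    calc ((k + 1 : ℕ) : ℝ) * (T e / N e) ≤ N e * (T e / N e) := by gcongr
      _ = T e := mul_div_cancel₀ _ hN'.ne'
  have hlt : (k : ℝ) * (T e / N e) < ((k + 1 : ℕ) : ℝ) * (T e / N e) := by
    push_cast
    linarith
  obtain ⟨r, hr, rfl⟩ : ∃ r, (r = (k : ℝ) * (T e / N e) ∨ r = ((k + 1 : ℕ) : ℝ) * (T e / N e)) ∧
      p = e.pt (M e r) := by
    rcases hp with rfl | rfl
    · exact ⟨_, Or.inl rfl, rfl⟩
    · exact ⟨_, Or.inr rfl, rfl⟩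
  have key := (h e he).lfs_div_bounds he (by positivity) hlt hk1 hr
  have hdiff : ((k + 1 : ℕ) : ℝ) * (T e / N e) - k * (T e / N e) = T e / N e := by
    push_cast
    ring
  rw [hdiff, one_div_div] at key
  exact ⟨(hAB e he).1.trans key.1, key.2.trans (hAB e he).2⟩

/-- The splittings obtained from the mapping functions are progressively refined. -/
lemma exists_progressivelyRefined (M : Seg → ℝ → ℝ) (T : Seg → ℝ)
    (h : ∀ e ∈ G.segs, G.IsMappingFunction e (M e) (T e)) :
    ∃ (S : ℕ → G.Splitting) (A B : ℕ → ℝ),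
      (∀ n, 1 ≤ n → G.IsODESplitting M T n (S n)) ∧ G.ProgressivelyRefined S A B := by
  -- c is T_min; without segments `sInf ∅ = 0` would not be positive, and any positive number
  -- serves.
  obtain ⟨c, hc, hcT⟩ : ∃ c : ℝ, 0 < c ∧
      ∀ e ∈ G.segs, sInf (T '' (G.segs : Set Seg)) = c ∧ c ≤ T e := by
    by_cases hne : G.segs.Nonempty
    · have hfin : (T '' (G.segs : Set Seg)).Finite := G.segs.finite_toSet.image T
      obtain ⟨e₀, he₀, hmin⟩ :=
        (Set.Nonempty.image T (Finset.coe_nonempty.2 hne)).csInf_mem hfin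
      refine ⟨_, (hmin ▸ (h e₀ he₀).1 : 0 < sInf (T '' (G.segs : Set Seg))), fun e he => ?_⟩
      exact ⟨rfl, csInf_le hfin.bddBelow ⟨e, he, rfl⟩⟩
    · exact ⟨1, one_pos, fun e he => (hne ⟨e, he⟩).elim⟩
  -- `max n 1` makes the sequence of splittings defined at n = 0 too.
  let N : ℕ → Seg → ℕ := fun n e => ⌊((max n 1 : ℕ) : ℝ) * (T e / sInf (T '' (G.segs : Set Seg)))⌋₊
  have hN : ∀ n, ∀ e ∈ G.segs, 0 < N n e := by
    intro n e he
    obtain ⟨h1, h2⟩ := hcT e he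
    refine Nat.floor_pos.2 ?_
    have h3 : (1 : ℝ) ≤ (max n 1 : ℕ) := by exact_mod_cast le_max_right n 1
    have h4 : 1 ≤ T e / c := (one_le_div hc).2 h2
    rw [h1]
    nlinarith
  -- Since T_e ≥ c, the floor satisfies (n - 1) / c ≤ N_e / T_e ≤ n / c; the further ∓1 is the error
  -- in `lfs_div_bounds`.
  refine ⟨fun n => odeSplitting M T h (N n) (hN n), fun n => (n - 1) / c - 1,
    fun n => n / c + 1, ?_, ?_, ?_, ?_⟩
  · intro n hn e he
    refine ⟨?_, fun k _ => rfl⟩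
    change N n e = _
    simp only [N, max_eq_left hn]
  · filter_upwards [((tendsto_natCast_atTop_atTop (R := ℝ)).eventually_gt_atTop (1 + c)),
      eventually_ge_atTop 1] with n hn hn1
    refine odeSplitting_bounds h (hN n) ?_ fun e he => ?_
    · rw [sub_pos, one_lt_div hc]
      linarith
    · obtain ⟨h1, h2⟩ := hcT e he
      have hT := (h e he).1
      have hNe : (N n e : ℝ) = (⌊(n : ℝ) * (T e / c)⌋₊ : ℝ) := by
        simp only [N, max_eq_left hn1, h1]
      have hle : (N n e : ℝ) ≤ n * (T e / c) := by
        rw [hNe]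
        exact Nat.floor_le (by positivity)
      have hge : (n : ℝ) * (T e / c) - 1 < N n e := by
        rw [hNe]
        exact Nat.sub_one_lt_floor _
      have e1 : (n : ℝ) * (T e / c) = n / c * T e := by ring
      constructor
      · have h3 : (n - 1) / c ≤ N n e / T e := by
          rw [le_div_iff₀ hT, sub_div, sub_mul]
          have : 1 ≤ 1 / c * T e := by
            rw [one_div, ← div_eq_inv_mul]
            exact (one_le_div hc).2 h2
          linarith
        linarith
      · have h3 : N n e / T e ≤ n / c := by
          rw [div_le_iff₀ hT]
          linarith
        linarith
  · have h1 : Tendsto (fun n : ℕ => (n : ℝ)) atTop atTop := tendsto_natCast_atTop_atTop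
    have h2 := (tendsto_atTop_add_const_right _ (-1 : ℝ) h1).atTop_div_const hc
    exact tendsto_atTop_add_const_right _ (-1 : ℝ) h2
  · have h1 : Tendsto (fun n : ℕ => ((n : ℝ))⁻¹) atTop (𝓝 0) := tendsto_inv_atTop_nhds_zero_nat
    have h2 : Tendsto (fun n : ℕ => (1 + c * (n : ℝ)⁻¹) / (1 - (1 + c) * (n : ℝ)⁻¹)) atTop
        (𝓝 ((1 + c * 0) / (1 - (1 + c) * 0))) :=
      (tendsto_const_nhds.add (h1.const_mul c)).div
        (tendsto_const_nhds.sub (h1.const_mul (1 + c))) (by norm_num)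
    simp only [mul_zero, add_zero, sub_zero, div_one] at h2
    refine h2.congr' ?_
    filter_upwards [((tendsto_natCast_atTop_atTop (R := ℝ)).eventually_gt_atTop (1 + c))]
      with n hn
    have hn0 : (n : ℝ) ≠ 0 := by linarith
    have h3 : (n : ℝ) - (1 + c) ≠ 0 := by linarith
    have h4 : (n : ℝ) - 1 - c ≠ 0 := by linarith
    have h5 : 1 - (1 + c) * (n : ℝ)⁻¹ = (n - 1 - c) / n := by
      field_simp
      ring
    have h6 : ((n : ℝ) - 1) / c - 1 = (n - 1 - c) / c := by
      field_simp
    rw [h5, h6]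
    field_simp

end PSLG

/-! ### Triangles -/

/-- A simplex contains points of its interior near each of its points. -/
lemma exists_mem_interior_convexHull {t : Finset Plane} (hcard : t.card = 3)
    (ht : AffineIndependent ℝ (fun v : t => (v : Plane))) {U : Set Plane} (hU : IsOpen U)
    {z : Plane} (hzU : z ∈ U) (hz : z ∈ convexHull ℝ (t : Set Plane)) :
    ∃ b ∈ interior (convexHull ℝ (t : Set Plane)), b ∈ U := by
  have hspan : affineSpan ℝ (t : Set Plane) = ⊤ := by
    have h := ht.affineSpan_eq_top_iff_card_eq_finrank_add_one.2 (by simp [hcard])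
    simpa using h
  have hne := interior_convexHull_nonempty_iff_affineSpan_eq_top.2 hspan
  have hz' : z ∈ closure (interior (convexHull ℝ (t : Set Plane))) := by
    rw [(convex_convexHull ℝ _).closure_interior_eq_closure_of_nonempty_interior hne]
    exact subset_closure hz
  obtain ⟨b, hbU, hb⟩ := mem_closure_iff.1 hz' U hU hzU
  exact ⟨b, hb, hbU⟩

lemma exists_isCircumcircle {t : Finset Plane} (hcard : t.card = 3)
    (ht : AffineIndependent ℝ (fun v : t => (v : Plane))) : ∃ o r, IsCircumcircle t o r := by
  have : Nonempty t := by
    obtain ⟨v, hv⟩ := Finset.card_pos.1 (by omega : 0 < t.card)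
    exact ⟨⟨v, hv⟩⟩
  obtain ⟨s, ⟨-, hs⟩, -⟩ := ht.existsUnique_dist_eq
  exact ⟨s.center, s.radius, fun v hv => hs ⟨⟨v, hv⟩, rfl⟩⟩

/-- The smallest angle of a triangle is opposite to a shortest edge. -/
lemma exists_third_vertex {t : Finset Plane} (hcard : t.card = 3)
    (ht : AffineIndependent ℝ (fun v : t => (v : Plane))) {p q : Plane}
    (hpq : IsShortestEdge t p q) :
    ∃ w ∈ t, ¬ Collinear ℝ {p, q, w} ∧ ∀ τ, τ ≤ ∠ p w q → τ ≤ minAngle t := by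
  obtain ⟨hp, hq, hne, hmin⟩ := hpq
  obtain ⟨w, hw⟩ : ∃ w, t = {p, q, w} := by
    have h1 : (t \ {p, q}).card = 1 := by
      rw [Finset.card_sdiff_of_subset (by simp [Finset.insert_subset_iff, hp, hq]), hcard,
        Finset.card_pair hne]
    obtain ⟨w, hw⟩ := Finset.card_eq_one.1 h1
    refine ⟨w, ?_⟩
    ext z
    have := Finset.ext_iff.1 hw z
    simp only [Finset.mem_sdiff, Finset.mem_insert, Finset.mem_singleton] at this ⊢
    by_cases h1 : z = p
    · simp [h1, hp]
    by_cases h2 : z = q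
    · simp [h2, hq]
    simpa [h1, h2] using this
  have hwt : w ∈ t := by simp [hw]
  have hwp : w ≠ p := by
    rintro rfl
    rw [hw, Finset.insert_comm, Finset.pair_eq_singleton, Finset.card_pair hne.symm] at hcard
    omega
  have hwq : w ≠ q := by
    rintro rfl
    rw [hw, Finset.pair_eq_singleton, Finset.card_pair hne] at hcard
    omega
  have hcol : ¬ Collinear ℝ {p, q, w} := by
    rw [← affineIndependent_iff_not_collinear_set]
    let φ : Fin 3 ↪ t := ⟨![⟨p, hp⟩, ⟨q, hq⟩, ⟨w, hwt⟩], by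
      intro i j hij
      fin_cases i <;> fin_cases j <;> simp_all [Subtype.ext_iff, eq_comm]⟩
    have := ht.comp_embedding φ
    have hφ : ![p, q, w] = (fun v : t => (v : Plane)) ∘ φ := by
      funext i
      fin_cases i <;> rfl
    rwa [hφ]
  refine ⟨w, hwt, hcol, fun τ hτ => ?_⟩
  have hA : ∠ p w q ≤ ∠ w p q := by
    have hc : ¬ Collinear ℝ {q, p, w} := by rwa [insert_comm]
    have := (EuclideanGeometry.angle_le_iff_dist_le hc).2
      (by simpa [dist_comm] using hmin q hq w hwt hwq.symm)
    rwa [EuclideanGeometry.angle_comm, EuclideanGeometry.angle_comm q p w] at this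
  have hB : ∠ p w q ≤ ∠ p q w :=
    (EuclideanGeometry.angle_le_iff_dist_le hcol).2 (hmin p hp w hwt hwp.symm)
  refine le_csInf ⟨_, p, hp, w, hwt, q, hq, hwp.symm, hwq, hne.symm, rfl⟩ ?_
  rintro α ⟨a, ha, b, hb, c, hc, hab, hbc, hca, rfl⟩
  have h1 := EuclideanGeometry.angle_comm p w q
  have h2 := EuclideanGeometry.angle_comm w p q
  have h3 := EuclideanGeometry.angle_comm p q w
  simp only [hw, Finset.mem_insert, Finset.mem_singleton] at ha hb hc
  rcases hb with rfl | rfl | rfl <;> rcases ha with rfl | rfl | rfl <;>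
    rcases hc with rfl | rfl | rfl <;> first | exact absurd rfl ‹_› | linarith

/-! ### Splittings, conforming meshes and the Delaunay property -/

namespace PSLG

variable {G : PSLG}

/-- A point of a segment lies on one of its subsegments. -/
lemma Splitting.exists_mem_subsegment (S : G.Splitting) {e : Seg} (he : e ∈ G.segs) {z : Plane}
    (hz : z ∈ e.carrier) : ∃ k < S.num e, z ∈ segment ℝ (S.vertex e k) (S.vertex e (k + 1)) := by
  have h0 := Seg.len_pos (G.nondeg e he)
  rw [Seg.carrier, segment_eq_image_lineMap] at hz
  obtain ⟨τ, hτ, rfl⟩ := hz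
  -- The least such k is the subsegment sought: minimality puts its left end before the point.
  have hex : ∃ k, τ * e.len ≤ S.pos e (k + 1) := by
    refine ⟨S.num e - 1, ?_⟩
    rw [Nat.sub_add_cancel (S.num_pos e he), S.pos_num e he]
    nlinarith [hτ.2]
  classical
  have hk := Nat.find_spec hex
  have hlt : Nat.find hex < S.num e := by
    have : Nat.find hex ≤ S.num e - 1 := Nat.find_min' hex (by
      rw [Nat.sub_add_cancel (S.num_pos e he), S.pos_num e he]
      nlinarith [hτ.2])
    have := S.num_pos e he
    omega
  have hk' : S.pos e (Nat.find hex) ≤ τ * e.len := by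
    rcases Nat.eq_zero_or_pos (Nat.find hex) with h | h
    · rw [h, S.pos_zero e he]
      exact mul_nonneg hτ.1 h0.le
    · have := Nat.find_min hex (show Nat.find hex - 1 < _ by omega)
      rw [Nat.sub_add_cancel h] at this
      exact (not_le.1 this).le
  have hpos := S.pos_lt e he _ hlt
  refine ⟨Nat.find hex, hlt, ?_⟩
  generalize Nat.find hex = k at *
  have hI : τ ∈ segment ℝ (S.pos e k / e.len) (S.pos e (k + 1) / e.len) := by
    rw [segment_eq_Icc (by gcongr)]
    exact ⟨(div_le_iff₀ h0).2 hk', (le_div_iff₀ h0).2 hk⟩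
  have := mem_image_of_mem (AffineMap.lineMap e.1 e.2 : ℝ →ᵃ[ℝ] Plane) hI
  rwa [image_segment] at this

lemma Splitting.pos_mem_Icc (S : G.Splitting) {e : Seg} (he : e ∈ G.segs) {k : ℕ}
    (hk : k ≤ S.num e) : S.pos e k ∈ Icc 0 e.len := by
  have hmono : ∀ i j, i ≤ j → j ≤ S.num e → S.pos e i ≤ S.pos e j := by
    intro i j hij
    induction j, hij using Nat.le_induction with
    | base => exact fun _ => le_rfl
    | succ j _ ih => exact fun h => (ih (by omega)).trans (S.pos_lt e he j (by omega)).le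
  constructor
  · rw [← S.pos_zero e he]
    exact hmono 0 k (Nat.zero_le _) hk
  · rw [← S.pos_num e he]
    exact hmono k _ hk le_rfl

lemma Splitting.verticesOn_subset_carrier (S : G.Splitting) {e : Seg} (he : e ∈ G.segs) :
    S.verticesOn e ⊆ e.carrier := by
  rintro p ⟨k, hk, rfl⟩
  exact Seg.pt_mem_carrier (G.nondeg e he) (S.pos_mem_Icc he hk)

namespace IsConforming

variable {S : G.Splitting} {m : Mesh}

lemma verticesOn_subset (hm : G.IsConforming S m) {e : Seg} (he : e ∈ G.segs) :
    S.verticesOn e ⊆ m.verts := by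
  rintro p ⟨k, hk, rfl⟩
  rcases hk.lt_or_eq with hk | rfl
  · obtain ⟨t, ht, h1, -⟩ := hm.subsegment_edge e he k hk
    exact (hm.verts_eq _).2 ⟨t, ht, h1⟩
  · have hpos := S.num_pos e he
    obtain ⟨t, ht, -, h2⟩ := hm.subsegment_edge e he (S.num e - 1) (by omega)
    rw [Nat.sub_add_cancel hpos] at h2
    exact (hm.verts_eq _).2 ⟨t, ht, h2⟩

/-- Faces of triangles of the mesh meet in common faces. -/
lemma convexHull_inter (hm : G.IsConforming S m) {t t' : Finset Plane} (ht : t ∈ m.tris)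
    (ht' : t' ∈ m.tris) {a a' : Finset Plane} (ha : a ⊆ t) (ha' : a' ⊆ t') :
    convexHull ℝ (a : Set Plane) ∩ convexHull ℝ (a' : Set Plane) ⊆
      convexHull ℝ ((a : Set Plane) ∩ (a' : Set Plane)) := by
  classical
  rintro z ⟨hz, hz'⟩
  -- Face-to-face gives the common face of the whole triangles; affine independence within each
  -- triangle then cuts it down to a and to a'.
  have h1 : z ∈ convexHull ℝ ((t ∩ t' : Finset Plane) : Set Plane) := by
    rw [Finset.coe_inter, ← hm.face_to_face t ht t' ht']
    exact ⟨convexHull_mono (by exact_mod_cast ha) hz, convexHull_mono (by exact_mod_cast ha') hz'⟩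
  have h2 : z ∈ convexHull ℝ ((a ∩ (t ∩ t') : Finset Plane) : Set Plane) := by
    rw [Finset.coe_inter, (hm.nondeg t ht).convexHull_inter ha Finset.inter_subset_left]
    exact ⟨hz, h1⟩
  have h3 : z ∈ convexHull ℝ ((a ∩ (t ∩ t') ∩ a' : Finset Plane) : Set Plane) := by
    rw [Finset.coe_inter, (hm.nondeg t' ht').convexHull_inter
      (Finset.inter_subset_right.trans Finset.inter_subset_right) ha']
    exact ⟨h2, hz'⟩
  refine convexHull_mono ?_ h3
  intro y hy
  simp only [Finset.coe_inter, mem_inter_iff] at hy ⊢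
  exact ⟨hy.1.1, hy.2⟩

/-- A segment of the graph that crosses an edge of the mesh contains this edge. -/
lemma edge_subset_carrier (hm : G.IsConforming S m) {t : Finset Plane} (ht : t ∈ m.tris)
    {p q z : Plane} (hp : p ∈ t) (hq : q ∈ t) (hz : z ∈ segment ℝ p q) (hzp : z ≠ p) (hzq : z ≠ q)
    {g : Seg} (hg : g ∈ G.segs) (hzg : z ∈ g.carrier) : p ∈ g.carrier ∧ q ∈ g.carrier := by
  classical
  -- The subsegment through z is itself a mesh edge, so z lies in the hull of the vertices shared
  -- with pq. If p or q were off g, at most the other one would be shared, and z would equal it.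
  obtain ⟨k, hk, hzk⟩ := S.exists_mem_subsegment hg hzg
  obtain ⟨t', ht', h1, h2⟩ := hm.subsegment_edge g hg k hk
  have h := hm.convexHull_inter ht ht' (a := {p, q}) (a' := {S.vertex g k, S.vertex g (k + 1)})
    (by simp [Finset.insert_subset_iff, hp, hq]) (by simp [Finset.insert_subset_iff, h1, h2])
    (show z ∈ _ by
      simp only [Finset.coe_insert, Finset.coe_singleton, convexHull_pair]
      exact ⟨hz, hzk⟩)
  have hsub : ∀ y, y = S.vertex g k ∨ y = S.vertex g (k + 1) → y ∈ g.carrier := by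
    rintro y (rfl | rfl)
    · exact S.verticesOn_subset_carrier hg ⟨k, hk.le, rfl⟩
    · exact S.verticesOn_subset_carrier hg ⟨k + 1, hk, rfl⟩
  simp only [Finset.coe_insert, Finset.coe_singleton] at h
  by_contra hcon
  have hcon' : p ∉ g.carrier ∨ q ∉ g.carrier := by tauto
  rcases hcon' with hpg | hqg
  · have : ({p, q} ∩ {S.vertex g k, S.vertex g (k + 1)} : Set Plane) ⊆ {q} := by
      rintro y ⟨rfl | rfl, hy⟩
      · exact (hpg (hsub _ hy)).elim
      · rfl
    have := convexHull_mono this h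
    rw [convexHull_singleton] at this
    exact hzq this
  · have : ({p, q} ∩ {S.vertex g k, S.vertex g (k + 1)} : Set Plane) ⊆ {p} := by
      rintro y ⟨rfl | rfl, hy⟩
      · rfl
      · exact (hqg (hsub _ hy)).elim
    have := convexHull_mono this h
    rw [convexHull_singleton] at this
    exact hzp this

end IsConforming

/-- The bounds on ignored triangles draw on the refinement process only through this invariant and
`Refinement.isDelaunay`. -/
lemma Refinement.isConforming {S : G.Splitting} {A B θ : ℝ} {κ : MeshKind} {m : Mesh}
    (h : Refinement S A B θ κ m) : G.IsConforming S m := by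
  cases h <;> assumption

lemma Refinement.isDelaunay {S : G.Splitting} {A B θ : ℝ} {κ : MeshKind} {m : Mesh}
    (h : Refinement S A B θ κ m) : G.IsDelaunay κ m := by
  cases h <;> assumption

/-- A mesh vertex that is visible from a point of the interior of a triangle is not inside the
circumcircle. -/
lemma IsDelaunay.le_dist {κ : MeshKind} {m : Mesh} (h : G.IsDelaunay κ m) {t : Finset Plane}
    (ht : t ∈ m.tris) {o : Plane} {r : ℝ} (ho : IsCircumcircle t o r) {w b : Plane}
    (hw : w ∈ m.verts) (hb : b ∈ interior (convexHull ℝ (t : Set Plane))) (hbw : G.Visible b w) :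
    r ≤ dist w o := by
  by_contra! hlt
  cases κ with
  | truly => exact h t ht o r ho w hw hlt
  | constrained => exact h t ht o r ho w hw hlt b hb hbw

end PSLG

/-! ### Inscribed angles and the power of a point -/

/-- A lower bound for an angle by a bound for its cotangent. -/
lemma arctan_le_angle {V : Type*} [NormedAddCommGroup V] [InnerProductSpace ℝ V] {v w : V}
    {s K D : ℝ} (hs : 0 < s) (hK : 0 < K) (hD : 0 < D) (hvw : inner ℝ v w ≤ K * D)
    (h : ‖v‖ ^ 2 * ‖w‖ ^ 2 = inner ℝ v w ^ 2 + (s * D) ^ 2) :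
    Real.arctan (s / K) ≤ InnerProductGeometry.angle v w := by
  set I : ℝ := inner ℝ v w with hI
  -- A nonpositive inner product means an angle of at least π / 2, above every arctangent. Otherwise
  -- the tangent of the angle is s D / I.
  rcases le_or_gt I 0 with hI0 | hI0
  · exact (Real.arctan_lt_pi_div_two _).le.trans
      (Real.arccos_zero ▸
        Real.antitone_arccos (div_nonpos_of_nonpos_of_nonneg hI0 (by positivity)))
  have hsD : 0 < s * D := mul_pos hs hD
  have hN : 0 < ‖v‖ * ‖w‖ := by
    have : 0 < (‖v‖ * ‖w‖) ^ 2 := by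
      rw [mul_pow, h]
      positivity
    exact lt_of_le_of_ne (by positivity) fun h0 => by simp [← h0] at this
  have h1 : 1 - (I / (‖v‖ * ‖w‖)) ^ 2 = (s * D / (‖v‖ * ‖w‖)) ^ 2 := by
    rw [div_pow, div_pow, mul_pow, h]
    have : I ^ 2 + (s * D) ^ 2 ≠ 0 := by positivity
    field_simp
    ring
  rw [InnerProductGeometry.angle, ← hI, Real.arccos_eq_arctan (div_pos hI0 hN), h1,
    Real.sqrt_sq (div_pos hsD hN).le, div_div_div_cancel_right₀ hN.ne']
  refine Real.arctan_strictMono.monotone ?_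
  rw [div_le_div_iff₀ hK hI0]
  nlinarith

section Frame

variable {e₁ e₂ : Plane} {c s : ℝ}

lemma inner_frame (h₁ : ‖e₁‖ = 1) (h₂ : ‖e₂‖ = 1) (hc : inner ℝ e₁ e₂ = c) (a b a' b' : ℝ) :
    inner ℝ (a • e₁ + b • e₂) (a' • e₁ + b' • e₂) = a * a' + b * b' + c * (a * b' + b * a') := by
  have h := real_inner_comm e₁ e₂
  simp only [inner_add_left, inner_add_right, real_inner_smul_left, real_inner_smul_right,
    real_inner_self_eq_norm_sq, h, h₁, h₂, hc]
  ring

lemma norm_frame_add_sq (h₁ : ‖e₁‖ = 1) (h₂ : ‖e₂‖ = 1) (hc : inner ℝ e₁ e₂ = c) (a b : ℝ)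
    (X : Plane) : ‖a • e₁ + b • e₂ + X‖ ^ 2 =
      a ^ 2 + b ^ 2 + 2 * a * b * c + 2 * a * inner ℝ e₁ X + 2 * b * inner ℝ e₂ X + ‖X‖ ^ 2 := by
  rw [norm_add_sq_real, ← real_inner_self_eq_norm_sq (a • e₁ + b • e₂),
    inner_frame h₁ h₂ hc, inner_add_left, real_inner_smul_left, real_inner_smul_left]
  ring

lemma norm_frame_sq (h₁ : ‖e₁‖ = 1) (h₂ : ‖e₂‖ = 1) (hc : inner ℝ e₁ e₂ = c) (a b : ℝ) :
    ‖a • e₁ + b • e₂‖ ^ 2 = a ^ 2 + b ^ 2 + 2 * a * b * c := by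
  rw [← real_inner_self_eq_norm_sq, inner_frame h₁ h₂ hc]
  ring

/-- The coordinates with respect to two independent unit vectors. -/
lemma exists_coords (h₁ : ‖e₁‖ = 1) (h₂ : ‖e₂‖ = 1) (hc : inner ℝ e₁ e₂ = c)
    (hs : s ^ 2 + c ^ 2 = 1) (hs0 : 0 < s) :
    ∃ α β : Plane →ₗ[ℝ] ℝ, (∀ z, z = α z • e₁ + β z • e₂) ∧
      ∀ a b : ℝ, α (a • e₁ + b • e₂) = a ∧ β (a • e₁ + b • e₂) = b := by
  have hli : LinearIndependent ℝ ![e₁, e₂] := by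
    rw [LinearIndependent.pair_iff]
    intro a b hab
    have h := norm_frame_sq h₁ h₂ hc a b
    rw [hab, norm_zero] at h
    -- Completing the square in the norm, with s² = 1 - c².
    have h' : (a + b * c) ^ 2 + (b * s) ^ 2 = 0 := by
      linear_combination -h + b ^ 2 * hs
    have hb : b * s = 0 := by nlinarith [sq_nonneg (a + b * c), sq_nonneg (b * s)]
    have hb0 : b = 0 := (mul_eq_zero.1 hb).resolve_right hs0.ne'
    refine ⟨?_, hb0⟩
    rw [hb0] at h'
    simpa using h'
  let B := basisOfLinearIndependentOfCardEqFinrank hli (by simp)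
  have hB : ⇑B = ![e₁, e₂] := coe_basisOfLinearIndependentOfCardEqFinrank hli _
  have hB0 : B 0 = e₁ := by simp [hB]
  have hB1 : B 1 = e₂ := by simp [hB]
  refine ⟨B.coord 0, B.coord 1, fun z => ?_, fun a b => ?_⟩
  · have := B.sum_repr z
    rw [Fin.sum_univ_two, hB0, hB1] at this
    exact this.symm
  · rw [← hB0, ← hB1]
    simp [Module.Basis.coord_apply]

/-- The cotangent of the angle at which the segment between the points `x + a e₁` and `x + b e₂`
is seen from a point of a circle through them, in terms of the power of `x`. -/
lemma inner_sub_of_mem_circle (h₁ : ‖e₁‖ = 1) (h₂ : ‖e₂‖ = 1) (hc : inner ℝ e₁ e₂ = c)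
    {x o : Plane} {r a b α β : ℝ} (hp : dist (x + a • e₁) o = r) (hq : dist (x + b • e₂) o = r)
    (hw : dist (x + (α • e₁ + β • e₂)) o = r) :
    a * b * inner ℝ ((x + a • e₁) - (x + (α • e₁ + β • e₂)))
        ((x + b • e₂) - (x + (α • e₁ + β • e₂))) =
      (dist x o ^ 2 - r ^ 2 - a * b * c) * (a * β + b * α - a * b) := by
  have e1 : (x + a • e₁) - (x + (α • e₁ + β • e₂)) = (a - α) • e₁ + (-β) • e₂ := by module
  have e2 : (x + b • e₂) - (x + (α • e₁ + β • e₂)) = (-α) • e₁ + (b - β) • e₂ := by module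
  have hp' := norm_frame_add_sq h₁ h₂ hc a 0 (x - o)
  have hq' := norm_frame_add_sq h₁ h₂ hc 0 b (x - o)
  have hw' := norm_frame_add_sq h₁ h₂ hc α β (x - o)
  rw [show a • e₁ + (0 : ℝ) • e₂ + (x - o) = x + a • e₁ - o by module, ← dist_eq_norm, hp] at hp'
  rw [show (0 : ℝ) • e₁ + b • e₂ + (x - o) = x + b • e₂ - o by module, ← dist_eq_norm, hq] at hq'
  rw [show α • e₁ + β • e₂ + (x - o) = x + (α • e₁ + β • e₂) - o by module, ← dist_eq_norm,
    hw] at hw'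
  rw [e1, e2, inner_frame h₁ h₂ hc, dist_eq_norm x o]
  -- These weights cancel the unknown inner products of e₁ and e₂ with x - o.
  linear_combination -a * b * hw' + b * α * hp' + a * β * hq'

/-- The power of a point of a ray that meets a circle, in terms of the power of the origin. -/
lemma power_le_of_le_dist (h₁ : ‖e₁‖ = 1) {x o : Plane} {r a a' : ℝ} (ha : 0 < a) (haa' : a < a')
    (hp : dist (x + a • e₁) o = r) (hp' : r ≤ dist (x + a' • e₁) o) :
    dist x o ^ 2 - r ^ 2 ≤ a * a' := by
  have hr : 0 ≤ r := hp ▸ dist_nonneg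
  have h (d : ℝ) : dist (x + d • e₁) o ^ 2 = d ^ 2 + 2 * d * inner ℝ e₁ (x - o) + dist x o ^ 2 := by
    rw [dist_eq_norm, dist_eq_norm, show x + d • e₁ - o = d • e₁ + (x - o) by module,
      norm_add_sq_real, norm_smul, h₁, real_inner_smul_left, mul_one, Real.norm_eq_abs, sq_abs]
    ring
  have h1 := h a
  have h2 := h a'
  have h3 : r ^ 2 ≤ dist (x + a' • e₁) o ^ 2 := pow_le_pow_left₀ hr hp' 2
  rw [hp] at h1
  rw [h2] at h3
  -- Along the ray, the power is a monic quadratic with roots a and (power of x) / a; being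
  -- nonnegative at a' > a, it has its second root at most a'.
  have h4 : 0 ≤ (a' - a) * (a * a' - (dist x o ^ 2 - r ^ 2)) := by
    have : (a' - a) * (a * a' - (dist x o ^ 2 - r ^ 2)) =
        a * (a' ^ 2 + 2 * a' * inner ℝ e₁ (x - o) + dist x o ^ 2 - r ^ 2) := by
      linear_combination a' * h1
    rw [this]
    exact mul_nonneg ha.le (by linarith)
  linarith [nonneg_of_mul_nonneg_right h4 (sub_pos.2 haa')]

/-- The angle opposite to the edge between the points `x + a e₁` and `x + b e₂` in a triangle whose
circumcircle does not contain `x`, `x + a' e₁` and `x + b' e₂`, if `a' ≤ (1 + R) a` and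
`b' ≤ (1 + R) b`. -/
lemma arctan_le_angle_of_le_dist (h₁ : ‖e₁‖ = 1) (h₂ : ‖e₂‖ = 1) (hc : inner ℝ e₁ e₂ = c)
    (hs : s ^ 2 + c ^ 2 = 1) (hs0 : 0 < s) {x o w : Plane} {r a b a' b' R : ℝ} (hR : 1 ≤ R)
    (ha : 0 < a) (hb : 0 < b) (haa' : a < a') (hbb' : b < b') (ha' : a' ≤ (1 + R) * a)
    (hb' : b' ≤ (1 + R) * b) (hp : dist (x + a • e₁) o = r) (hq : dist (x + b • e₂) o = r)
    (hw : dist w o = r) (hcol : ¬ Collinear ℝ {x + a • e₁, x + b • e₂, w})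
    (hx : r ≤ dist x o) (hp' : r ≤ dist (x + a' • e₁) o) (hq' : r ≤ dist (x + b' • e₂) o) :
    Real.arctan (s / ((1 + R) - c)) ≤ ∠ (x + a • e₁) w (x + b • e₂) := by
  obtain ⟨α, β, hαβ, -⟩ := exists_coords h₁ h₂ hc hs hs0
  obtain ⟨A, B, rfl⟩ : ∃ A B : ℝ, w = x + (A • e₁ + B • e₂) :=
    ⟨α (w - x), β (w - x), by rw [← hαβ]; abel⟩
  have hab : 0 < a * b := mul_pos ha hb
  have hc1 : c < 1 := by nlinarith
  have hK : 0 < (1 + R) - c := by linarith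
  have hr : 0 ≤ r := hp ▸ dist_nonneg
  have hinner := inner_sub_of_mem_circle h₁ h₂ hc hp hq hw
  set π₀ := dist x o ^ 2 - r ^ 2 with hπ₀
  have hπ : 0 ≤ π₀ := sub_nonneg.2 (pow_le_pow_left₀ hr hx 2)
  -- Each ray bounds the power by (1 + R) times the square of its own distance; the smaller square
  -- is at most a b.
  have hπ1 : π₀ ≤ (1 + R) * (a * b) := by
    have h1 := power_le_of_le_dist h₁ ha haa' hp hp'
    have h2 := power_le_of_le_dist h₂ hb hbb' hq hq'
    rw [← hπ₀] at h1 h2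
    rcases le_total a b with h | h
    · calc π₀ ≤ a * a' := h1
        _ ≤ a * ((1 + R) * a) := by gcongr
        _ ≤ a * ((1 + R) * b) := by gcongr
        _ = _ := by ring
    · calc π₀ ≤ b * b' := h2
        _ ≤ b * ((1 + R) * b) := by gcongr
        _ ≤ b * ((1 + R) * a) := by gcongr
        _ = _ := by ring
  -- D vanishes exactly on the line pq, and s |D| is twice the area of the triangle.
  set D := a * B + b * A - a * b with hDdef
  have hD : D ≠ 0 := by
    intro hD
    apply hcol
    rw [collinear_iff_of_mem (p₀ := x + a • e₁) (by simp)]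
    refine ⟨b • e₂ - a • e₁, ?_⟩
    rintro z (rfl | rfl | rfl)
    · exact ⟨0, by simp⟩
    · exact ⟨1, by rw [vadd_eq_add]; module⟩
    · obtain ⟨k, hA, hB⟩ : ∃ k, A = a - k * a ∧ B = k * b := by
        refine ⟨B / b, ?_, by field_simp⟩
        field_simp
        linarith
      refine ⟨k, ?_⟩
      rw [vadd_eq_add, hA, hB]
      module
  have hnorm : ‖(x + a • e₁) - (x + (A • e₁ + B • e₂))‖ ^ 2 *
      ‖(x + b • e₂) - (x + (A • e₁ + B • e₂))‖ ^ 2 =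
      inner ℝ ((x + a • e₁) - (x + (A • e₁ + B • e₂)))
        ((x + b • e₂) - (x + (A • e₁ + B • e₂))) ^ 2 + (s * |D|) ^ 2 := by
    have e1 : (x + a • e₁) - (x + (A • e₁ + B • e₂)) = (a - A) • e₁ + (-B) • e₂ := by module
    have e2 : (x + b • e₂) - (x + (A • e₁ + B • e₂)) = (-A) • e₁ + (b - B) • e₂ := by module
    rw [e1, e2, norm_frame_sq h₁ h₂ hc, norm_frame_sq h₁ h₂ hc, inner_frame h₁ h₂ hc, mul_pow,
      sq_abs, hDdef]
    linear_combination -(a * B + b * A - a * b) ^ 2 * hs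
  refine arctan_le_angle hs0 hK (abs_pos.2 hD) ?_ hnorm
  change inner ℝ ((x + a • e₁) - (x + (A • e₁ + B • e₂)))
    ((x + b • e₂) - (x + (A • e₁ + B • e₂))) ≤ _
  rw [← mul_le_mul_iff_right₀ hab, hinner]
  -- For D < 0 the third vertex is on the side of x: the bound uses power ≥ 0 and 2c ≤ 1 + R. For D
  -- > 0 it uses the upper bound on the power.
  rcases hD.lt_or_gt with h | h
  · rw [abs_of_neg h]
    have h3 : a * b * c ≤ a * b * ((1 + R) - c) := by
      gcongr
      linarith
    nlinarith
  · rw [abs_of_pos h]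
    nlinarith

end Frame

/-! ### Split segments near a vertex of the graph -/

namespace PSLG

variable {G : PSLG}

/-- Near a vertex there are only segments with this endpoint. -/
lemma exists_radius (G : PSLG) {x : Plane} (hx : x ∈ G.verts) : ∃ ρ : ℝ, 0 < ρ ∧
    (∀ g ∈ G.segs, x ∉ g.ends → ∀ z ∈ g.carrier, ρ ≤ dist z x) ∧ ∀ g ∈ G.segs, ρ ≤ g.len := by
  have h : ∀ᶠ ρ in 𝓝[>] (0 : ℝ), ∀ g ∈ G.segs,
      (x ∉ g.ends → ∀ z ∈ g.carrier, ρ ≤ dist z x) ∧ ρ ≤ g.len := by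
    rw [Finset.eventually_all]
    intro g hg
    refine Eventually.and ?_ (eventually_nhdsWithin_of_eventually_nhds
      (eventually_le_nhds (Seg.len_pos (G.nondeg g hg))))
    by_cases hxg : x ∈ g.ends
    · simp [hxg]
    · have hpos : 0 < Metric.infDist x g.carrier :=
        Seg.infDist_carrier_pos fun h => hxg (G.vert_on_seg g hg x hx h)
      filter_upwards [eventually_nhdsWithin_of_eventually_nhds (eventually_le_nhds hpos)] with
        ρ hρ _ z hz
      rw [dist_comm]
      exact hρ.trans (Metric.infDist_le_dist_of_mem hz)
  obtain ⟨ρ, hρ, hρ0⟩ := (h.and self_mem_nhdsWithin).exists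
  exact ⟨ρ, hρ0, fun g hg => (hρ g hg).1, fun g hg => (hρ g hg).2⟩

/-- LFS at the shared vertex lies between A and B times the length of each of the two subsegments.
-/
lemma Splitting.SizeOptimal.subLen_le {S : G.Splitting} {A B : ℝ} (hS : S.SizeOptimal A B)
    {e : Seg} (he : e ∈ G.segs) {k : ℕ} (hk : k + 1 < S.num e) :
    S.subLen e k ≤ B / A * S.subLen e (k + 1) ∧ S.subLen e (k + 1) ≤ B / A * S.subLen e k := by
  obtain ⟨hA, hS⟩ := hS
  have h1 := hS e he k (by omega) (S.vertex e (k + 1)) (by simp)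
  have h2 := hS e he (k + 1) hk (S.vertex e (k + 1)) (by simp)
  have l1 : 0 < S.subLen e k := sub_pos.2 (S.pos_lt e he k (by omega))
  have l2 : 0 < S.subLen e (k + 1) := sub_pos.2 (S.pos_lt e he (k + 1) hk)
  rw [le_div_iff₀ l1, div_le_iff₀ l1] at h1
  rw [le_div_iff₀ l2, div_le_iff₀ l2] at h2
  rw [div_mul_eq_mul_div, div_mul_eq_mul_div, le_div_iff₀ hA, le_div_iff₀ hA]
  constructor <;> linarith

lemma Splitting.SizeOptimal.one_le_div {S : G.Splitting} {A B : ℝ} (hS : S.SizeOptimal A B)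
    {e : Seg} (he : e ∈ G.segs) : 1 ≤ B / A := by
  obtain ⟨hA, hS⟩ := hS
  have h := hS e he 0 (S.num_pos e he) (S.vertex e 0) (by simp)
  exact (_root_.one_le_div hA).2 (h.1.trans h.2)

/-- A vertex of a split segment, other than its endpoint `x`, and the next vertex seen
from `x`. -/
lemma Splitting.SizeOptimal.exists_next_vertex {S : G.Splitting} {A B : ℝ}
    (hS : S.SizeOptimal A B) {e : Seg} (he : e ∈ G.segs) {x u : Plane}
    (hxu : e = (x, u) ∨ e = (u, x)) {p : Plane} (hp : p ∈ S.verticesOn e) (hpx : p ≠ x) :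
    ∃ a : ℝ, 0 < a ∧ p = x + a • ((dist x u)⁻¹ • (u - x)) ∧ (a < dist x u →
      ∃ a', a < a' ∧ a' ≤ (1 + B / A) * a ∧
        x + a' • ((dist x u)⁻¹ • (u - x)) ∈ S.verticesOn e) := by
  have hR := hS.one_le_div he
  have hmem := fun k hk => S.pos_mem_Icc he (k := k) hk
  obtain ⟨k, hk, rfl⟩ := hp
  rcases hxu with rfl | rfl
  · have hlen : Seg.len (x, u) = dist x u := rfl
    have hv (k : ℕ) : S.vertex (x, u) k =
        x + S.pos (x, u) k • ((dist x u)⁻¹ • (u - x)) := by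
      rw [vertex, Seg.pt, AffineMap.lineMap_apply_module', hlen, smul_smul, div_eq_mul_inv, add_comm]
    rw [hv] at hpx
    refine ⟨_, (hmem k hk).1.lt_of_ne fun h => hpx (by rw [← h]; simp), hv k, fun hlt => ?_⟩
    have hk' : k < S.num (x, u) := hk.lt_of_ne fun h => by
      rw [h, S.pos_num _ he] at hlt
      exact hlt.ne hlen
    obtain ⟨j, rfl⟩ : ∃ j, k = j + 1 := Nat.exists_eq_succ_of_ne_zero fun h => hpx (by
      rw [h, S.pos_zero _ he]
      simp)
    refine ⟨_, S.pos_lt _ he _ hk', ?_, ⟨_, hk', (hv _).symm⟩⟩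
    -- The subsegment beyond p is at most R times the one before it, which lies between x and p and
    -- so has length at most a.
    have h1 := (hS.subLen_le he hk').2
    have h2 := (hmem j (by omega)).1
    simp only [subLen] at h1
    nlinarith
  · have hlen : Seg.len (u, x) = dist x u := dist_comm _ _
    have hux : dist x u ≠ 0 := by
      rw [← hlen]
      exact (Seg.len_pos (G.nondeg _ he)).ne'
    have hv (k : ℕ) : S.vertex (u, x) k =
        x + (dist x u - S.pos (u, x) k) • ((dist x u)⁻¹ • (u - x)) := by
      rw [vertex, Seg.pt, AffineMap.lineMap_apply_module', hlen, smul_smul, sub_mul,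
        mul_inv_cancel₀ hux, ← div_eq_mul_inv]
      module
    rw [hv] at hpx
    refine ⟨_, ?_, hv k, fun hlt => ?_⟩
    · rw [sub_pos]
      refine lt_of_le_of_ne (hlen ▸ (hmem k hk).2) fun h => hpx (by rw [h]; simp)
    have hk' : k < S.num (u, x) := hk.lt_of_ne fun h => hpx (by
      rw [h, S.pos_num _ he, hlen]
      simp)
    obtain ⟨j, rfl⟩ : ∃ j, k = j + 1 := Nat.exists_eq_succ_of_ne_zero fun h => by
      rw [h, S.pos_zero _ he] at hlt
      simp at hlt
    -- Here x is the last vertex, so moving away from x lowers the index.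
    refine ⟨dist x u - S.pos (u, x) j, ?_, ?_, ⟨j, by omega, (hv _).symm⟩⟩
    · linarith [S.pos_lt _ he j (by omega)]
    have h1 := (hS.subLen_le he hk').1
    have h2 := (hmem (j + 1 + 1) hk').2
    rw [hlen] at h2
    simp only [subLen] at h1
    nlinarith

end PSLG

/-! ### Visibility near a corner -/

namespace PSLG

variable {G : PSLG}

/-- Near a corner `x` of the graph, no segment separates the edge between the points `x + a e₁` and
`x + b e₂` on the two sides of the corner from the points of the sector between the sides. -/
lemma IsConforming.exists_visible {S : G.Splitting} {m : Mesh} (hm : G.IsConforming S m)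
    {e₁ e₂ : Plane} {c s : ℝ} (h₁ : ‖e₁‖ = 1) (h₂ : ‖e₂‖ = 1) (hc : inner ℝ e₁ e₂ = c)
    (hs : s ^ 2 + c ^ 2 = 1) (hs0 : 0 < s) {x : Plane} {ρ : ℝ}
    (hρ₁ : ∀ g ∈ G.segs, x ∉ g.ends → ∀ z ∈ g.carrier, ρ ≤ dist z x)
    (hρ₂ : ∀ g ∈ G.segs, ρ ≤ g.len) {e f : Seg} (he : e ∈ G.segs) (hf : f ∈ G.segs) (hef : e ≠ f)
    {t : Finset Plane} (ht : t ∈ m.tris) {a b : ℝ} (ha : 0 < a) (haρ : a < ρ) (hb : 0 < b)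
    (hbρ : b < ρ) (hpt : x + a • e₁ ∈ t) (hqt : x + b • e₂ ∈ t) (hpe : x + a • e₁ ∈ e.carrier)
    (hqf : x + b • e₂ ∈ f.carrier) (hpe' : x + a • e₁ ∉ e.ends) (hqf' : x + b • e₂ ∉ f.ends) :
    ∃ z ∈ interior (convexHull ℝ (t : Set Plane)), ∀ α β : ℝ, 0 ≤ α → 0 ≤ β →
      ‖α • e₁ + β • e₂‖ < ρ → G.Visible z (x + (α • e₁ + β • e₂)) := by
  obtain ⟨X, Y, hXY, hXY'⟩ := exists_coords h₁ h₂ hc hs hs0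
  set p := x + a • e₁ with hp
  set q := x + b • e₂ with hq
  have hXp : X (p - x) = a ∧ Y (p - x) = 0 := by
    rw [show p - x = a • e₁ + (0 : ℝ) • e₂ by rw [hp]; module]
    exact hXY' a 0
  have hXq : X (q - x) = 0 ∧ Y (q - x) = b := by
    rw [show q - x = (0 : ℝ) • e₁ + b • e₂ by rw [hq]; module]
    exact hXY' 0 b
  have hpball : p ∈ Metric.ball x ρ := by
    rw [mem_ball_iff_norm, hp, add_sub_cancel_left, norm_smul, h₁, mul_one, Real.norm_eq_abs,
      abs_of_pos ha]
    exact haρ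
  have hqball : q ∈ Metric.ball x ρ := by
    rw [mem_ball_iff_norm, hq, add_sub_cancel_left, norm_smul, h₂, mul_one, Real.norm_eq_abs,
      abs_of_pos hb]
    exact hbρ
  have hXc : Continuous X := X.continuous_of_finiteDimensional
  have hYc : Continuous Y := Y.continuous_of_finiteDimensional
  have hU : IsOpen ({z : Plane | 0 < X (z - x)} ∩ {z : Plane | 0 < Y (z - x)} ∩ Metric.ball x ρ) :=
    ((isOpen_lt continuous_const (by fun_prop)).inter
      (isOpen_lt continuous_const (by fun_prop))).inter Metric.isOpen_ball
  have hmid : midpoint ℝ p q - x = (a / 2) • e₁ + (b / 2) • e₂ := by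
    rw [midpoint_eq_smul_add, hp, hq, invOf_eq_inv]
    module
  -- The viewpoint is an interior point of the triangle so close to the midpoint of pq that it lies
  -- in the open sector and the ball, on whichever side of pq the triangle is.
  obtain ⟨z₀, hz₀, ⟨hXz, hYz⟩, hz₀ball⟩ :=
    exists_mem_interior_convexHull (hm.card_eq t ht) (hm.nondeg t ht) hU (z := midpoint ℝ p q)
      ⟨⟨by rw [mem_ofPred_eq, hmid, (hXY' _ _).1]; positivity,
        by rw [mem_ofPred_eq, hmid, (hXY' _ _).2]; positivity⟩,
        (convex_ball x ρ).segment_subset hpball hqball (midpoint_mem_segment p q)⟩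
      (segment_subset_convexHull hpt hqt (midpoint_mem_segment p q))
  rw [mem_ofPred_eq] at hXz hYz
  refine ⟨z₀, hz₀, fun α β hα hβ hαβ g hg => ?_⟩
  rw [disjoint_left]
  intro z hz hzg
  have hyball : x + (α • e₁ + β • e₂) ∈ Metric.ball x ρ := by
    rwa [mem_ball_iff_norm, add_sub_cancel_left]
  have hzball : z ∈ Metric.ball x ρ :=
    (convex_ball x ρ).segment_subset hz₀ball hyball (openSegment_subset_segment ℝ _ _ hz)
  obtain ⟨hXz', hYz'⟩ : 0 < X (z - x) ∧ 0 < Y (z - x) := by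
    obtain ⟨σ, τ, hσ, hτ, hστ, rfl⟩ := hz
    have : σ • z₀ + τ • (x + (α • e₁ + β • e₂)) - x =
        σ • (z₀ - x) + τ • (α • e₁ + β • e₂) := by
      obtain rfl : σ = 1 - τ := by linarith
      module
    rw [this, map_add, map_add, map_smul, map_smul, map_smul, map_smul, (hXY' _ _).1,
      (hXY' _ _).2]
    simp only [smul_eq_mul]
    exact ⟨by positivity, by positivity⟩
  set α' := X (z - x)
  set β' := Y (z - x)
  have hzx : z - x = α' • e₁ + β' • e₂ := hXY (z - x)
  have hden : 0 < α' * b + β' * a := by positivity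
  -- Scaling by σ about x projects the blocking point z onto the edge pq.
  set σ := a * b / (α' * b + β' * a) with hσ
  have hσ0 : 0 < σ := by positivity
  have hw₁ : σ * α' / a + σ * β' / b = 1 := by
    rw [hσ]
    field_simp
  have hz' : x + σ • (z - x) = (σ * α' / a) • p + (σ * β' / b) • q := by
    have e1 : (σ * α' / a) • p = (σ * α' / a) • x + (σ * α') • e₁ := by
      rw [hp, smul_add, smul_smul, div_mul_cancel₀ _ ha.ne']
    have e2 : (σ * β' / b) • q = (σ * β' / b) • x + (σ * β') • e₂ := by
      rw [hq, smul_add, smul_smul, div_mul_cancel₀ _ hb.ne']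
    rw [e1, e2, hzx, show (σ * β' / b) = 1 - σ * α' / a by linarith]
    module
  have hz'seg : x + σ • (z - x) ∈ segment ℝ p q :=
    ⟨_, _, by positivity, by positivity, hw₁, hz'.symm⟩
  have hz'ball := (convex_ball x ρ).segment_subset hpball hqball hz'seg
  have hz'p : x + σ • (z - x) ≠ p := fun h => by
    have h' := hXp.2
    rw [← h, add_sub_cancel_left, map_smul, smul_eq_mul] at h'
    exact (mul_pos hσ0 hYz').ne' h'
  have hz'q : x + σ • (z - x) ≠ q := fun h => by
    have h' := hXq.1
    rw [← h, add_sub_cancel_left, map_smul, smul_eq_mul] at h'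
    exact (mul_pos hσ0 hXz').ne' h'
  have hxg : x ∈ g.ends := by
    by_contra hxg
    exact (hρ₁ g hg hxg z hzg).not_gt hzball
  obtain ⟨y, hgy, hxy⟩ : ∃ y, g.carrier = segment ℝ x y ∧ ρ ≤ dist x y := by
    have hlen := hρ₂ g hg
    rcases hxg with h | h
    · exact ⟨g.2, by rw [h, Seg.carrier], by rw [h]; exact hlen⟩
    · refine ⟨g.1, by rw [h, Seg.carrier, segment_symm], ?_⟩
      rw [h, dist_comm]
      exact hlen
  -- g starts at x and has length at least ρ, so it still contains the projected point, which is
  -- within ρ of x.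
  have hz'g : x + σ • (z - x) ∈ g.carrier := by
    rw [hgy, segment_eq_image'] at hzg ⊢
    obtain ⟨τ, hτ, rfl⟩ := hzg
    rw [add_sub_cancel_left, smul_smul] at hz'ball ⊢
    refine ⟨σ * τ, ⟨mul_nonneg hσ0.le hτ.1, ?_⟩, rfl⟩
    rw [mem_ball_iff_norm, add_sub_cancel_left, norm_smul, ← dist_eq_norm, dist_comm,
      Real.norm_eq_abs, abs_of_nonneg (mul_nonneg hσ0.le hτ.1)] at hz'ball
    by_contra! hcon
    nlinarith [dist_nonneg (x := x) (y := y)]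
  obtain ⟨hpg, hqg⟩ := hm.edge_subset_carrier ht hpt hqt hz'seg hz'p hz'q hg hz'g
  by_cases hge : g = e
  · subst hge
    exact hqf' (G.inter_subset g he f hf hef ⟨hqg, hqf⟩).2
  · exact hpe' (G.inter_subset e he g hg (Ne.symm hge) ⟨hpe, hpg⟩).1

/-! ### The angle bound at a corner -/

lemma Corner.ne_left {e f : Seg} {u x v : Plane} (h : G.Corner e f u x v) : x ≠ u := by
  obtain ⟨he, -, -, rfl | rfl, -⟩ := h
  · exact G.nondeg _ he
  · exact (G.nondeg _ he).symm

lemma Corner.symm {e f : Seg} {u x v : Plane} (h : G.Corner e f u x v) : G.Corner f e v x u :=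
  ⟨h.2.1, h.1, h.2.2.1.symm, h.2.2.2.2, h.2.2.2.1⟩

lemma Corner.ends_eq {e f : Seg} {u x v : Plane} (h : G.Corner e f u x v) : e.ends = {x, u} := by
  obtain ⟨-, -, -, rfl | rfl, -⟩ := h
  · rfl
  · exact pair_comm _ _

lemma Corner.carrier_eq {e f : Seg} {u x v : Plane} (h : G.Corner e f u x v) :
    e.carrier = segment ℝ x u := by
  obtain ⟨-, -, -, rfl | rfl, -⟩ := h
  · rfl
  · exact segment_symm ℝ _ _

lemma Corner.len_eq {e f : Seg} {u x v : Plane} (h : G.Corner e f u x v) :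
    e.len = dist x u := by
  obtain ⟨-, -, -, rfl | rfl, -⟩ := h
  · rfl
  · exact dist_comm _ _

/-- At angle 0 the far end of the shorter segment would lie on the longer one, hence be a common
endpoint; both would then cover the same set and share a midpoint, which is not an endpoint. -/
lemma Corner.angle_pos {e f : Seg} {u x v : Plane} (h : G.Corner e f u x v) : 0 < ∠ u x v := by
  refine (EuclideanGeometry.angle_nonneg _ _ _).lt_of_ne fun h0 => ?_
  have key : ∀ {e f : Seg} {u v : Plane}, G.Corner e f u x v → ∠ u x v = 0 →
      ¬ dist x u ≤ dist x v := by
    intro e f u v h h0 hle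
    obtain ⟨-, r, hr, hr'⟩ := InnerProductGeometry.angle_eq_zero_iff.1 h0
    simp only [vsub_eq_sub] at hr'
    have hr1 : 1 ≤ r := by
      have h1 := h.ne_left
      rw [dist_comm x v, dist_comm x u, dist_eq_norm, dist_eq_norm, hr', norm_smul,
        Real.norm_of_nonneg hr.le] at hle
      have : 0 < ‖u - x‖ := norm_pos_iff.2 (sub_ne_zero.2 h1.symm)
      exact le_of_mul_le_mul_right (by linarith) this
    have hu : u ∈ f.carrier := by
      rw [h.symm.carrier_eq, segment_eq_image']
      refine ⟨r⁻¹, ⟨by positivity, inv_le_one_of_one_le₀ hr1⟩, ?_⟩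
      simp only [hr']
      rw [inv_smul_smul₀ hr.ne']
      abel
    have hu' : u ∈ e.carrier := by
      rw [h.carrier_eq]
      exact right_mem_segment ℝ x u
    have huf := (G.inter_subset e h.1 f h.2.1 h.2.2.1 ⟨hu', hu⟩).2
    rw [h.symm.ends_eq] at huf
    rcases huf with huf | huf
    · exact h.ne_left huf.symm
    · have huf : u = v := huf
      subst huf
      have hmid : midpoint ℝ x u ∈ e.carrier ∩ f.carrier := by
        rw [h.carrier_eq, h.symm.carrier_eq]
        exact ⟨midpoint_mem_segment _ _, midpoint_mem_segment _ _⟩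
      have := (G.inter_subset e h.1 f h.2.1 h.2.2.1 hmid).1
      rw [h.ends_eq] at this
      rcases this with h2 | h2
      · exact h.ne_left ((midpoint_eq_left_iff ℝ).1 h2)
      · exact h.ne_left ((midpoint_eq_right_iff ℝ).1 h2)
  rcases le_total (dist x u) (dist x v) with hle | hle
  · exact key h h0.symm hle
  · refine key h.symm ?_ hle
    rw [EuclideanGeometry.angle_comm]
    exact h0.symm

/-- The triangles across a corner of the graph whose shortest edge is close to the corner. -/
lemma Corner.arctan_le_minAngle {e f : Seg} {u x v : Plane} (h : G.Corner e f u x v)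
    (hφ : ∠ u x v < Real.pi) {ρ : ℝ}
    (hρ₁ : ∀ g ∈ G.segs, x ∉ g.ends → ∀ z ∈ g.carrier, ρ ≤ dist z x)
    (hρ₂ : ∀ g ∈ G.segs, ρ ≤ g.len) {S : G.Splitting} {A B : ℝ} (hS : S.SizeOptimal A B)
    {κ : MeshKind} {m : Mesh} (hm : G.IsConforming S m) (hD : G.IsDelaunay κ m) {t : Finset Plane}
    (ht : t ∈ m.tris) {p q : Plane} (hp : p ∈ S.verticesOn e) (hq : q ∈ S.verticesOn f)
    (hpx : p ≠ x) (hqx : q ≠ x) (hpq : IsShortestEdge t p q)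
    (hlt : (1 + B / A) * dist p q < ρ * Real.sin (∠ u x v)) :
    Real.arctan (Real.sin (∠ u x v) / ((1 + B / A) - Real.cos (∠ u x v))) ≤ minAngle t := by
  have hux := dist_pos.2 h.ne_left
  have hvx := dist_pos.2 h.symm.ne_left
  have hR := hS.one_le_div h.1
  have hs0 : 0 < Real.sin (∠ u x v) := Real.sin_pos_of_pos_of_lt_pi h.angle_pos hφ
  have hs := Real.sin_sq_add_cos_sq (∠ u x v)
  obtain ⟨a, ha, hpa, ha'⟩ := hS.exists_next_vertex h.1 h.2.2.2.1 hp hpx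
  obtain ⟨b, hb, hqb, hb'⟩ := hS.exists_next_vertex h.2.1 h.2.2.2.2 hq hqx
  have h₁ : ‖(dist x u)⁻¹ • (u - x)‖ = 1 := by
    rw [norm_smul, ← dist_eq_norm, dist_comm u x, norm_inv, Real.norm_of_nonneg hux.le,
      inv_mul_cancel₀ hux.ne']
  have h₂ : ‖(dist x v)⁻¹ • (v - x)‖ = 1 := by
    rw [norm_smul, ← dist_eq_norm, dist_comm v x, norm_inv, Real.norm_of_nonneg hvx.le,
      inv_mul_cancel₀ hvx.ne']
  have hc : inner ℝ ((dist x u)⁻¹ • (u - x)) ((dist x v)⁻¹ • (v - x)) = Real.cos (∠ u x v) := by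
    rw [EuclideanGeometry.angle, InnerProductGeometry.cos_angle, real_inner_smul_left,
      real_inner_smul_right, vsub_eq_sub, vsub_eq_sub, ← dist_eq_norm, ← dist_eq_norm,
      dist_comm u, dist_comm v]
    field_simp
  have hpe := S.verticesOn_subset_carrier h.1 hp
  have hqf := S.verticesOn_subset_carrier h.2.1 hq
  have hendu : a < dist x u → p ∉ e.ends := by
    rw [h.ends_eq]
    rintro hlt (h1 | h1)
    · exact hpx h1
    · have : a = dist x u := by
        have h2 : dist p x = a := by
          rw [hpa, dist_eq_norm, add_sub_cancel_left, norm_smul, h₁, mul_one,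
            Real.norm_of_nonneg ha.le]
        rw [← h2, h1, dist_comm]
      exact hlt.ne this
  have hendv : b < dist x v → q ∉ f.ends := by
    rw [h.symm.ends_eq]
    rintro hlt (h1 | h1)
    · exact hqx h1
    · have : b = dist x v := by
        have h2 : dist q x = b := by
          rw [hqb, dist_eq_norm, add_sub_cancel_left, norm_smul, h₂, mul_one,
            Real.norm_of_nonneg hb.le]
        rw [← h2, h1, dist_comm]
      exact hlt.ne this
  have hρu := hρ₂ e h.1
  have hρv := hρ₂ f h.2.1
  rw [h.len_eq] at hρu
  rw [h.symm.len_eq] at hρv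
  generalize (dist x u)⁻¹ • (u - x) = e₁ at *
  generalize (dist x v)⁻¹ • (v - x) = e₂ at *
  generalize Real.sin (∠ u x v) = s at *
  generalize Real.cos (∠ u x v) = c at *
  generalize B / A = R at *
  have hdist : dist p q ^ 2 = a ^ 2 + b ^ 2 - 2 * a * b * c := by
    rw [dist_eq_norm, hpa, hqb, show x + a • e₁ - (x + b • e₂) = a • e₁ + (-b) • e₂ by module,
      norm_frame_sq h₁ h₂ hc]
    ring
  -- a sin φ is the distance of p from the line of f. With `hlt` this puts p and the next vertex
  -- within ρ of x.
  have has : a * s ≤ dist p q := by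
    refine abs_le_of_sq_le_sq' ?_ dist_nonneg |>.2
    nlinarith [sq_nonneg (b - a * c)]
  have hbs : b * s ≤ dist p q := by
    refine abs_le_of_sq_le_sq' ?_ dist_nonneg |>.2
    nlinarith [sq_nonneg (a - b * c)]
  have haρ : (1 + R) * a < ρ := by
    refine lt_of_mul_lt_mul_right ?_ hs0.le
    nlinarith
  have hbρ : (1 + R) * b < ρ := by
    refine lt_of_mul_lt_mul_right ?_ hs0.le
    nlinarith
  have haρ' : a < ρ := by nlinarith
  have hbρ' : b < ρ := by nlinarith
  obtain ⟨a', haa', ha'R, ha'S⟩ := ha' (haρ'.trans_le hρu)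
  obtain ⟨b', hbb', hb'R, hb'S⟩ := hb' (hbρ'.trans_le hρv)
  have hpe' := hendu (haρ'.trans_le hρu)
  have hqf' := hendv (hbρ'.trans_le hρv)
  obtain ⟨w, hw, hcol, hmin⟩ := exists_third_vertex (hm.card_eq t ht) (hm.nondeg t ht) hpq
  obtain ⟨hpt, hqt, -, -⟩ := hpq
  obtain ⟨o, r, ho⟩ := exists_isCircumcircle (hm.card_eq t ht) (hm.nondeg t ht)
  subst hpa hqb
  obtain ⟨z, hz, hvis⟩ := hm.exists_visible h₁ h₂ hc hs hs0 hρ₁ hρ₂ h.1 h.2.1 h.2.2.1 ht ha haρ' hb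
    hbρ' hpt hqt hpe hqf hpe' hqf'
  have hxv : x ∈ m.verts := by
    have h0 := hm.verticesOn_subset h.1
    obtain ⟨he, -, -, rfl | rfl, -⟩ := h
    · exact h0 ⟨0, Nat.zero_le _, by rw [Splitting.vertex, S.pos_zero _ he, Seg.pt_zero]⟩
    · exact h0 ⟨_, le_rfl, by rw [Splitting.vertex, S.pos_num _ he, Seg.pt_len (G.nondeg _ he)]⟩
  have hρ0 : 0 < ρ := ha.trans haρ'
  refine hmin _ (arctan_le_angle_of_le_dist h₁ h₂ hc hs hs0 hR ha hb haa' hbb' ha'R hb'R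
    (ho _ hpt) (ho _ hqt) (ho _ hw) hcol ?_ ?_ ?_)
  · refine hD.le_dist ht ho hxv hz ?_
    simpa using hvis 0 0 le_rfl le_rfl (by simpa using hρ0)
  · refine hD.le_dist ht ho (hm.verticesOn_subset h.1 ha'S) hz ?_
    have h0 : 0 ≤ a' := by linarith
    simpa using hvis a' 0 h0 le_rfl (by
      rw [zero_smul, add_zero, norm_smul, h₁, mul_one, Real.norm_of_nonneg h0]
      linarith)
  · refine hD.le_dist ht ho (hm.verticesOn_subset h.2.1 hb'S) hz ?_
    have h0 : 0 ≤ b' := by linarith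
    simpa using hvis 0 b' le_rfl h0 (by
      rw [zero_smul, zero_add, norm_smul, h₂, mul_one, Real.norm_of_nonneg h0]
      linarith)

end PSLG

/-! ### Limits along progressively refined splittings -/

namespace PSLG

variable {G : PSLG}

lemma ProgressivelyRefined.tendsto_B {S : ℕ → G.Splitting} {A B : ℕ → ℝ}
    (hS : G.ProgressivelyRefined S A B) : Tendsto B atTop atTop := by
  refine (hS.2.2.pos_mul_atTop one_pos hS.2.1).congr' ?_
  filter_upwards [hS.2.1.eventually_gt_atTop 0] with n hn
  exact div_mul_cancel₀ _ hn.ne'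

lemma lfs_le_len {e : Seg} {p : Plane} (hp : p ∈ e.carrier) : G.lfs e p ≤ e.len := by
  have h1 : e.1 ∈ e.carrier := left_mem_segment ℝ _ _
  have h2 : e.2 ∈ e.carrier := right_mem_segment ℝ _ _
  rw [Seg.carrier, segment_eq_image_lineMap] at hp
  obtain ⟨τ, hτ, rfl⟩ := hp
  refine (lfs_le_max e _).trans (max_le ?_ ?_)
  · rw [dist_lineMap_left, Real.norm_of_nonneg hτ.1]
    exact mul_le_of_le_one_left dist_nonneg hτ.2
  · rw [dist_lineMap_right, Real.norm_of_nonneg (sub_nonneg.2 hτ.2)]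
    exact mul_le_of_le_one_left dist_nonneg (sub_le_self _ hτ.1)

lemma Corner.mem_verts {e f : Seg} {u x v : Plane} (h : G.Corner e f u x v) :
    u ∈ G.verts ∧ x ∈ G.verts := by
  obtain ⟨he, -, -, rfl | rfl, -⟩ := h
  · exact (G.ends_mem _ he).symm
  · exact G.ends_mem _ he

/-- The lower bound on the minimum angle of the ignored triangles across a corner. -/
lemma Corner.eventually_arctan_le_minAngle {e f : Seg} {u x v : Plane} (h : G.Corner e f u x v)
    {S : ℕ → G.Splitting} {A B : ℕ → ℝ} (hS : G.ProgressivelyRefined S A B) (θ : ℝ) :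
    ∀ᶠ n in atTop, ∀ (κ : MeshKind) (m : Mesh), Refinement (S n) (A n) (B n) θ κ m →
      ∀ t ∈ m.tris, IgnoredAt (S n) (A n) (B n) θ e f u x v t →
        Real.arctan (Real.sin (∠ u x v) / ((1 + B n / A n) - Real.cos (∠ u x v)))
          ≤ minAngle t := by
  -- A straight angle has sine 0, but it exceeds the threshold arccos(1 / (2R)) ≤ π / 2, so nothing
  -- is ignored across it.
  rcases (EuclideanGeometry.angle_le_pi u x v).eq_or_lt with hφ | hφ
  · filter_upwards [hS.1] with n hn κ m hm t ht hign
    have h1 := hign.2.1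
    have hR := hn.one_le_div h.1
    rw [hφ] at h1
    have h2 : Real.arccos (1 / (2 * (B n / A n))) ≤ Real.pi / 2 :=
      Real.arccos_le_pi_div_two.2 (by positivity)
    linarith [Real.pi_pos]
  obtain ⟨ρ, hρ, hρ₁, hρ₂⟩ := G.exists_radius h.mem_verts.2
  have hs0 : 0 < Real.sin (∠ u x v) := Real.sin_pos_of_pos_of_lt_pi h.angle_pos hφ
  set L := max e.len f.len with hL
  have hlim : Tendsto (fun n => (1 + B n / A n) * (L / B n)) atTop (𝓝 ((1 + 1) * 0)) :=
    (tendsto_const_nhds.add hS.2.2).mul (hS.tendsto_B.const_div_atTop L)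
  rw [mul_zero] at hlim
  filter_upwards [hS.1, hlim.eventually_lt_const (mul_pos hρ hs0),
    hS.tendsto_B.eventually_gt_atTop 0] with n hn hlt hB κ m hm t ht hign
  obtain ⟨-, -, ⟨p, hp, q, hq, hpx, hqx, hpq, hshort⟩, -⟩ := hign
  have hR := hn.one_le_div h.1
  refine h.arctan_le_minAngle hφ hρ₁ hρ₂ hn hm.isConforming hm.isDelaunay ht hp hq hpx hqx hpq
    (lt_of_le_of_lt ?_ hlt)
  have hd : dist p q ≤ L / B n := by
    rcases hshort with h1 | h1
    · refine h1.le.trans ?_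
      gcongr
      exact (lfs_le_len ((S n).verticesOn_subset_carrier h.1 hp)).trans (le_max_left _ _)
    · refine h1.le.trans ?_
      gcongr
      exact (lfs_le_len ((S n).verticesOn_subset_carrier h.2.1 hq)).trans (le_max_right _ _)
  gcongr

lemma ProgressivelyRefined.tendsto_bound {S : ℕ → G.Splitting} {A B : ℕ → ℝ}
    (hS : G.ProgressivelyRefined S A B) (φ : ℝ) :
    Tendsto (fun n => Real.arctan (Real.sin φ / ((1 + B n / A n) - Real.cos φ))) atTop
      (𝓝 (Real.arctan (Real.sin φ / (2 - Real.cos φ)))) := by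
  refine (Real.continuous_arctan.tendsto _).comp (tendsto_const_nhds.div ?_ ?_)
  · have := (hS.2.2.const_add 1).sub_const (Real.cos φ)
    norm_num at this
    exact this
  · linarith [Real.cos_le_one φ]

/-- The limit of the lower bounds increases with the angle, for angles up to `π / 3`. -/
lemma sin_div_two_sub_cos_le {φ ψ : ℝ} (hφ : 0 ≤ φ) (hφψ : φ ≤ ψ) (hψ : ψ ≤ Real.pi / 3) :
    Real.sin φ / (2 - Real.cos φ) ≤ Real.sin ψ / (2 - Real.cos ψ) := by
  rw [div_le_div_iff₀ (by linarith [Real.cos_le_one φ]) (by linarith [Real.cos_le_one ψ])]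
  -- Cross-multiplied, the claim is sin(ψ - φ) ≤ 2 (sin ψ - sin φ). Both sides contain the factor
  -- sin((ψ - φ) / 2), and cos((ψ + φ) / 2) ≥ 1 / 2.
  have h1 := Real.sin_sub ψ φ
  have h2 := Real.sin_sub_sin ψ φ
  have h3 : Real.sin (ψ - φ) = 2 * Real.sin ((ψ - φ) / 2) * Real.cos ((ψ - φ) / 2) := by
    rw [← Real.sin_two_mul, mul_div_cancel₀ _ two_ne_zero]
  have h4 : 0 ≤ Real.sin ((ψ - φ) / 2) :=
    Real.sin_nonneg_of_nonneg_of_le_pi (by linarith) (by linarith [Real.pi_pos])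
  have h5 : 1 / 2 ≤ Real.cos ((ψ + φ) / 2) := by
    rw [← Real.cos_pi_div_three]
    exact Real.cos_le_cos_of_nonneg_of_le_pi (by linarith) (by linarith [Real.pi_pos])
      (by linarith)
  have h6 := Real.cos_le_one ((ψ - φ) / 2)
  nlinarith [mul_le_mul_of_nonneg_left h5 h4, mul_le_mul_of_nonneg_left h6 h4]

/-- The ignored triangles across a corner, in terms of a lower bound for the angle. -/
lemma Corner.eventually_sub_le_minAngle {e f : Seg} {u x v : Plane} (h : G.Corner e f u x v)
    {S : ℕ → G.Splitting} {A B : ℕ → ℝ} (hS : G.ProgressivelyRefined S A B) (θ : ℝ) {φ ε : ℝ}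
    (hφ : 0 ≤ φ) (hφ' : φ ≤ ∠ u x v) (hε : 0 < ε) :
    ∀ᶠ n in atTop, ∀ (κ : MeshKind) (m : Mesh), Refinement (S n) (A n) (B n) θ κ m →
      ∀ t ∈ m.tris, IgnoredAt (S n) (A n) (B n) θ e f u x v t →
        Real.arctan (Real.sin φ / (2 - Real.cos φ)) - ε ≤ minAngle t := by
  -- Up to π / 3 the limit bound is monotone; beyond it the threshold, which tends to π / 3,
  -- eventually rules out ignored triangles.
  rcases le_or_gt (∠ u x v) (Real.pi / 3) with hψ | hψ
  · have hle : Real.arctan (Real.sin φ / (2 - Real.cos φ)) - ε <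
        Real.arctan (Real.sin (∠ u x v) / (2 - Real.cos (∠ u x v))) := by
      have := Real.arctan_mono (sin_div_two_sub_cos_le hφ hφ' hψ)
      linarith
    filter_upwards [h.eventually_arctan_le_minAngle hS θ,
      (hS.tendsto_bound (∠ u x v)).eventually_const_lt hle] with n hn hlt κ m hm t ht hign
    exact hlt.le.trans (hn κ m hm t ht hign)
  · have hlim : Tendsto (fun n => Real.arccos (1 / (2 * (B n / A n)))) atTop
        (𝓝 (Real.arccos (1 / (2 * 1)))) :=
      (Real.continuous_arccos.tendsto _).comp
        (tendsto_const_nhds.div (hS.2.2.const_mul 2) (by norm_num))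
    have h3 : Real.arccos (1 / (2 * 1)) = Real.pi / 3 := by
      rw [mul_one, ← Real.cos_pi_div_three, Real.arccos_cos] <;> linarith [Real.pi_pos]
    rw [h3] at hlim
    filter_upwards [hlim.eventually_lt_const hψ] with n hn κ m hm t ht hign
    exact absurd hign.2.1 (not_le.2 hn)

end PSLG


theorem mainTheorem3 (G : PSLG) (θ : ℝ) (hθ : 0 < θ) (hθ' : θ < Real.pi / 6) :
    -- the splittings obtained from the mapping functions are progressively refined
    (∀ (M : Seg → ℝ → ℝ) (T : Seg → ℝ),
      (∀ e ∈ G.segs, G.IsMappingFunction e (M e) (T e)) →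
      ∃ (S : ℕ → G.Splitting) (A B : ℕ → ℝ),
        (∀ n, 1 ≤ n → G.IsODESplitting M T n (S n)) ∧ G.ProgressivelyRefined S A B) ∧
    -- for all progressively refined splittings:
    (∀ (S : ℕ → G.Splitting) (A B : ℕ → ℝ), G.ProgressivelyRefined S A B →
      -- the lower bound on the minimum angle of the ignored triangles across an angle
      (∀ (e f : Seg) (u x v : Plane), G.Corner e f u x v →
        Tendsto (fun n => Real.arctan
            (Real.sin (∠ u x v) / ((1 + B n / A n) - Real.cos (∠ u x v)))) atTop
          (𝓝 (Real.arctan (Real.sin (∠ u x v) / (2 - Real.cos (∠ u x v))))) ∧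
        ∀ᶠ n in atTop, ∀ (κ : MeshKind) (m : Mesh),
          PSLG.Refinement (S n) (A n) (B n) θ κ m →
          ∀ t ∈ m.tris, PSLG.IgnoredAt (S n) (A n) (B n) θ e f u x v t →
            Real.arctan (Real.sin (∠ u x v) / ((1 + B n / A n) - Real.cos (∠ u x v)))
              ≤ minAngle t) ∧
      -- the minimum angle of the final meshes
      (∀ φ : ℝ, IsLeast G.angles φ → ∀ ε : ℝ, 0 < ε →
        ∀ᶠ n in atTop, ∀ (κ : MeshKind) (m : Mesh),
          PSLG.IsRefinedMesh (S n) (A n) (B n) θ κ m →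
          ∀ t ∈ m.tris,
            min θ (Real.arctan (Real.sin φ / (2 - Real.cos φ)) - ε) ≤ minAngle t)) := by
  refine ⟨PSLG.exists_progressivelyRefined, fun S A B hS => ⟨fun e f u x v h =>
    ⟨hS.tendsto_bound _, h.eventually_arctan_le_minAngle hS θ⟩, fun φ hφ ε hε => ?_⟩⟩
  have hφ0 : 0 ≤ φ := by
    obtain ⟨e, f, u, x, v, -, rfl⟩ := hφ.1
    exact EuclideanGeometry.angle_nonneg _ _ _
  -- Corners range over finite sets, so one n serves all of them.
  have key : ∀ᶠ n in atTop, ∀ e ∈ G.segs, ∀ f ∈ G.segs, ∀ u ∈ G.verts, ∀ x ∈ G.verts,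
      ∀ v ∈ G.verts, G.Corner e f u x v → ∀ (κ : MeshKind) (m : Mesh),
        PSLG.Refinement (S n) (A n) (B n) θ κ m →
        ∀ t ∈ m.tris, PSLG.IgnoredAt (S n) (A n) (B n) θ e f u x v t →
          Real.arctan (Real.sin φ / (2 - Real.cos φ)) - ε ≤ minAngle t := by
    simp only [Finset.eventually_all]
    intro e _ f _ u _ x _ v _
    by_cases h : G.Corner e f u x v
    · filter_upwards [h.eventually_sub_le_minAngle hS θ hφ0 (hφ.2 ⟨e, f, u, x, v, h, rfl⟩) hε]
        with n hn _ using hn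
    · exact Eventually.of_forall fun n h' => absurd h' h
  filter_upwards [key] with n hn κ m hm t ht
  rcases le_or_gt θ (minAngle t) with hθt | hθt
  · exact (min_le_left _ _).trans hθt
  · have hign : ∃ e f u x v, PSLG.IgnoredAt (S n) (A n) (B n) θ e f u x v t := by
      by_contra hcon
      exact hm.2 t ht ⟨hθt, hcon⟩
    obtain ⟨e, f, u, x, v, hign⟩ := hign
    have h := hign.1
    exact (min_le_right _ _).trans (hn e h.1 f h.2.1 u h.mem_verts.1 x h.mem_verts.2 v
      h.symm.mem_verts.1 h κ m hm.1 t ht hign)
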